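/- Let $K$ be a field, $c\ge 1$ and $i\ge 0$ integers, and let $\mathbb{N}$ denote the positive integers. For $n\ge 1$ let $R_n=K[x_{k,j}\mid 1\le k\le c,\ 1\le j\le n]$ with the standard grading. Let $\mathrm{Inc}(\mathbb{N})^i$ be the set of strictly increasing maps $\pi:\mathbb{N}\to\mathbb{N}$ with $\pi(j)=j$ for all $j\le i$; such a $\pi$ acts by $x_{k,j}\mapsto x_{k,\pi(j)}$. Let $\mathcal{I}=(I_n)_{n\ge 1}$ be a nonzero $\mathrm{Inc}(\mathbb{N})^i$-invariant chain of monomial ideals, that is: each $I_n\subseteq R_n$ is a monomial ideal, some $I_n$ is nonzero, and $\pi(I_m)\subseteq I_n$ whenever $m\le n$, $\pi\in\mathrm{Inc}(\mathbb{N})^i$ and $\pi(m)\le n$. For a monomial $u\ne 1$ let $\min(u)$ be the smallest $j$ such that some $x_{k,j}$ divides $u$, and put $\min(1)=0$. For an integer $s\ge 0$ let $w_k^{(s)}(u)$ be the largest exponent in $u$ of a variable $x_{k,j}$ with $j>s$ ($0$ if there is no such variable), and let $w^{(s)}(u)=\max_k w_k^{(s)}(u)$. For a nonzero monomial ideal $J\subseteq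 R_n$ with minimal set of monomial generators $G(J)$, let $G^{(s)}_+(J)=\{u\in G(J)\mid \min(u)>s\}$ and set \[ w_k^{(s)}(J)=\max_{u\in G(J)} w_k^{(s)}(u),\qquad \omega^{(s)}(J)=\begin{cases}\min\{w^{(s)}(u)\mid u\in G^{(s)}_+(J)\}&\text{if } G^{(s)}_+(J)\neq\emptyset,\\ \max\{w^{(s)}(u)\mid u\in G(J)\}&\text{otherwise.}\end{cases} \] Then there are (unique) integers $w_1(\mathcal{I}),\dots,w_c(\mathcal{I})$ and $\omega(\mathcal{I})$ such that for all $s\gg 0$ one has $w_k^{(s)}(I_n)=w_k(\mathcal{I})$ for all $k$ and $\omega^{(s)}(I_n)=\omega(\mathcal{I})$ for all $n\gg 0$ (depending on $s$). Set \[ C(\mathcal{I})=\max\{\omega(\mathcal{I})-1,0\}+\max_{1\le l\le c}\ \sum_{k\ne l} w_k(\mathcal{I}). \] Then there is a constant $D$ (depending on $\mathcal{I}$) such that \[ \operatorname{reg}(I_n)\le C(\mathcal{I})\,n+D\qquad\text{for all } n\gg 0, \] where $\operatorname{reg}(I_n)=\max\{j-p\mid \operatorname{Tor}^{R_n}_p(K,I_n)_j\ne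 0\}$ is the Castelnuovo-Mumford regularity. -/

import Mathlib

open Filter

noncomputable section

namespace IncChain

/-! ### Graded Tor and Castelnuovo-Mumford regularity of a homogeneous ideal -/

section Regularity

variable {K : Type*} [Field K] {σ : Type*}

/-- A graded free resolution `⋯ → F₂ → F₁ → F₀ → I → 0` of an ideal `I` of the standard graded
polynomial ring `S = K[σ]`. The module `F p` is free on `B p`, the basis vector `b : B p` lies in
degree `deg p b` (so `F p` is the direct sum of the `S(-deg p b)`), and all maps are homogeneous of
degree `0`. -/
structure GradedFreeResolution (I : Ideal (MvPolynomial σ K)) where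
  B : ℕ → Type
  deg : ∀ p, B p → ℤ
  d : ∀ p, (B (p + 1) →₀ MvPolynomial σ K) →ₗ[MvPolynomial σ K] (B p →₀ MvPolynomial σ K)
  aug : (B 0 →₀ MvPolynomial σ K) →ₗ[MvPolynomial σ K] MvPolynomial σ K
  homogeneous_d : ∀ p (b : B (p + 1)) (b' : B p) (m : σ →₀ ℕ),
    (d p (Finsupp.single b 1) b').coeff m ≠ 0 → deg (p + 1) b = deg p b' + (m.degree : ℤ)
  homogeneous_aug : ∀ (b : B 0) (m : σ →₀ ℕ),
    (aug (Finsupp.single b 1)).coeff m ≠ 0 → deg 0 b = (m.degree : ℤ)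
  range_aug : LinearMap.range aug = I
  exact_aug : Function.Exact (d 0) aug
  exact_d : ∀ p, Function.Exact (d (p + 1)) (d p)

namespace GradedFreeResolution

variable {I : Ideal (MvPolynomial σ K)} (F : GradedFreeResolution I)

/-- The differential of `K ⊗ F`, where `K` is the residue field of `S` at the ideal of the
variables: `K ⊗ F p` is the `K`-vector space on `B p`, and the entries of the matrix of `F.d p` are
replaced by their constant coefficients. -/
def dBar (p : ℕ) : (F.B (p + 1) →₀ K) →ₗ[K] (F.B p →₀ K) :=
  Finsupp.linearCombination K fun b =>
    (F.d p (Finsupp.single b 1)).mapRange MvPolynomial.constantCoeff (map_zero _)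

/-- The degree `j` part of `K ⊗ F p`. -/
def degreePart (p : ℕ) (j : ℤ) : Submodule K (F.B p →₀ K) :=
  Finsupp.supported K K {b | F.deg p b = j}

/-- The `p`-cycles of degree `j` of `K ⊗ F`. -/
def cycles : ∀ p : ℕ, ℤ → Submodule K (F.B p →₀ K)
  | 0, j => F.degreePart 0 j
  | p + 1, j => F.degreePart (p + 1) j ⊓ LinearMap.ker (F.dBar p)

/-- The `p`-boundaries of degree `j` of `K ⊗ F`. -/
def boundaries (p : ℕ) (j : ℤ) : Submodule K (F.B p →₀ K) :=
  (F.degreePart (p + 1) j).map (F.dBar p)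

end GradedFreeResolution

/-- `Tor_p^S(K, I)_j ≠ 0`: the vector space `Tor_p^S(K, I)_j = H_p(K ⊗ F)_j` is the quotient of the
cycles by the boundaries, so it is nonzero when some cycle is not a boundary. (Up to isomorphism,
this quotient does not depend on the graded free resolution `F`.) -/
def TorNonzero (I : Ideal (MvPolynomial σ K)) (p : ℕ) (j : ℤ) : Prop :=
  ∃ F : GradedFreeResolution I, ∃ z ∈ F.cycles p j, z ∉ F.boundaries p j

/-- The Castelnuovo-Mumford regularity `reg I = max {j - p | Tor_p^S(K, I)_j ≠ 0}`, as a supremum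
of extended reals: it is `⊤` if the set is unbounded above and `⊥` if it is empty. -/
def reg (I : Ideal (MvPolynomial σ K)) : EReal :=
  ⨆ (p : ℕ) (j : ℤ) (_ : TorNonzero I p j), (((j - p : ℤ) : ℝ) : EReal)

/-- An ideal generated by monomials. -/
def IsMonomialIdeal (I : Ideal (MvPolynomial σ K)) : Prop :=
  ∃ s : Set (σ →₀ ℕ), I = Ideal.span ((fun u => MvPolynomial.monomial u (1 : K)) '' s)

/-- The (exponent vectors of the) minimal monomial generators of a monomial ideal: the monomials
of `I` that are minimal with respect to divisibility. -/
def minGens (I : Ideal (MvPolynomial σ K)) : Set (σ →₀ ℕ) :=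
  {u | Minimal (fun v => MvPolynomial.monomial v (1 : K) ∈ I) u}

end Regularity

/-! ### The rings `R_n`, the monoids `Inc(ℕ)^i` and invariant chains

Column indices are counted from `0`: the variable `x_{k,j}` with `1 ≤ k ≤ c` and `1 ≤ j ≤ n` is
`X (k - 1, j - 1)`. Monomials are represented by their exponent vectors. -/

/-- The polynomial ring `R_n = K[x_{k,j} | k ∈ [c], j ∈ [n]]`. -/
abbrev R (K : Type*) [Field K] (c n : ℕ) : Type _ := MvPolynomial (Fin c × Fin n) K

/-- `Inc(ℕ)^i`: the strictly increasing maps that fix the first `i` elements. -/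
def Inc (i : ℕ) : Set (ℕ → ℕ) := {π | StrictMono π ∧ ∀ j < i, π j = j}

section Chain

variable {K : Type*} [Field K] {c : ℕ}

/-- The action `x_{k,j} ↦ x_{k,π(j)}` of a map `π` on `R_m`, with values in `R_n`, for `π` that maps
the first `m` elements into the first `n` elements. -/
def act {m n : ℕ} (π : ℕ → ℕ) (h : ∀ j < m, π j < n) : R K c m →ₐ[K] R K c n :=
  MvPolynomial.rename fun v => (v.1, ⟨π v.2, h v.2 v.2.isLt⟩)

/-- `(I_n)_{n ≥ 1}` is an `Inc(ℕ)^i`-invariant chain of ideals. (The term `I 0` plays no role.) -/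
def IsInvariantChain (i : ℕ) (I : ∀ n, Ideal (R K c n)) : Prop :=
  ∀ m n, 1 ≤ m → m ≤ n → ∀ π ∈ Inc i, ∀ h : ∀ j < m, π j < n, ∀ f ∈ I m, act π h f ∈ I n

/-! ### Weights -/

/-- `min(u)`: the smallest column index (counted from `1`) of a variable that divides `u`, with
`min(1) = 0` (the infimum of the empty set of natural numbers is `0`). -/
def minIndex {n : ℕ} (u : Fin c × Fin n →₀ ℕ) : ℕ :=
  sInf {j | ∃ v ∈ u.support, j = (v.2 : ℕ) + 1}

/-- `w_k^{(i)}(u)`: the largest exponent in `u` of a variable `x_{k,j}` with `j > i`. -/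
def monWeightRow {n : ℕ} (i : ℕ) (k : Fin c) (u : Fin c × Fin n →₀ ℕ) : ℕ :=
  (Finset.univ.filter fun j : Fin n => i < (j : ℕ) + 1).sup fun j => u (k, j)

/-- `w^{(i)}(u) = max_k w_k^{(i)}(u)`. -/
def monWeight {n : ℕ} (i : ℕ) (u : Fin c × Fin n →₀ ℕ) : ℕ :=
  Finset.univ.sup fun k => monWeightRow i k u

/-- `G_+^{(i)}(I)`: the minimal generators `u` with `min(u) > i`. -/
def minGensPlus {n : ℕ} (i : ℕ) (I : Ideal (R K c n)) : Set (Fin c × Fin n →₀ ℕ) :=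
  {u ∈ minGens I | i < minIndex u}

/-- `w_k^{(i)}(I)`. -/
def weightRow {n : ℕ} (i : ℕ) (k : Fin c) (I : Ideal (R K c n)) : ℕ :=
  sSup (monWeightRow i k '' minGens I)

open Classical in
/-- `ω^{(i)}(I)`. -/
def omega {n : ℕ} (i : ℕ) (I : Ideal (R K c n)) : ℕ :=
  if (minGensPlus i I).Nonempty then sInf (monWeight i '' minGensPlus i I)
  else sSup (monWeight i '' minGens I)

open Classical in
/-- The eventual value of an eventually constant sequence (and `0` for other sequences). -/
def eventualValue (f : ℕ → ℕ) : ℕ :=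
  if h : ∃ a, ∀ᶠ n in atTop, f n = a then h.choose else 0

/-- `w_k(𝓘)`: the value for `i ≫ 0` of `w_k^{(i)}(𝓘)`, which is the value of `w_k^{(i)}(I_n)`
for `n ≫ 0`. -/
def chainWeightRow (k : Fin c) (I : ∀ n, Ideal (R K c n)) : ℕ :=
  eventualValue fun i => eventualValue fun n => weightRow i k (I n)

/-- `ω(𝓘)`: the value for `i ≫ 0` of `ω^{(i)}(𝓘)`, which is the value of `ω^{(i)}(I_n)`
for `n ≫ 0`. -/
def chainOmega (I : ∀ n, Ideal (R K c n)) : ℕ :=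
  eventualValue fun i => eventualValue fun n => omega i (I n)

/-- `C(𝓘) = max {ω(𝓘) - 1, 0} + max_l ∑_{k ≠ l} w_k(𝓘)`. -/
def boundCoeff (I : ∀ n, Ideal (R K c n)) : ℤ :=
  max ((chainOmega I : ℤ) - 1) 0 +
    ((Finset.univ.sup fun l : Fin c => ∑ k ∈ Finset.univ.erase l, chainWeightRow k I : ℕ) : ℤ)

end Chain

end IncChain

end

/-! The module `Tor_p(K, I)` is the homology of the Koszul complex with coefficients in `I`. For a
monomial ideal, its part of multidegree `a` is the chain complex of the simplicial complex of those
squarefree `ρ` with `x^(a-ρ)` in `I`. This homology vanishes in homological degree `p` if some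
variable `v` dividing `x^a` is a cone point: for every `p`-subset `ρ` avoiding `v`, `x^(a-ρ)` in `I`
implies `x^(a-ρ)/v` in `I`. It therefore suffices to find a cone point whenever `deg a > C(𝓘) n + D
+ p` (`cycles_le_boundaries`, `reg_le_of_cone_points`).

The second ingredient is noetherianity up to symmetry. By Higman's lemma
(`exists_bounded_embedding`), there are `r` and `B` such that every monomial of the chain is
divisible by a shifted copy of one with at most `r` columns and exponents at most `B`. Consequently
minimal generators occupy at most `r` columns, weights are bounded by `B`, and deleting an empty
column makes the sets of weights decrease with `n`, so they stabilize.

Fix `s` large and let `a` have large degree (`exists_cone_point`). A variable whose exponent in `a`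
exceeds its exponent in all generators is a cone point. Otherwise row `k` of `a` is at most `w_k`
beyond column `s`, and any variable of `x^a` beyond column `s` works. Indeed, a column with an entry
below `ω` has degree at most `C(𝓘)`, so the large degree of `b = a - ρ - v` forces at least `r`
columns whose entries are all at least `ω`. The columns beyond `s` of a suitable monomial of weight
at most `ω` can be moved into these, hence `x^b` is in `I`. -/

noncomputable section

namespace IncChain

/-! ### Koszul complexes -/

section Koszul

variable {σ : Type*}

/-- The sign of inserting `v` into `τ`, with respect to the order induced by `e`. -/
def koszulSign (e : σ → ℕ) (v : σ) (τ : Finset σ) : ℤ :=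
  ∏ u ∈ τ, if e u < e v then -1 else 1

theorem koszulSign_mul_self (e : σ → ℕ) (v : σ) (τ : Finset σ) :
    koszulSign e v τ * koszulSign e v τ = 1 := by
  rw [koszulSign, ← Finset.prod_mul_distrib]
  refine Finset.prod_eq_one fun u _ => ?_
  split_ifs <;> norm_num

variable [DecidableEq σ]

/-- Exactly one of `u`, `v` precedes the other, so exactly one of the two signs changes when the
other element is inserted first. This form cancels the cross terms of the cone homotopy; the primed
form gives `∂² = 0`. -/
theorem koszulSign_swap {e : σ → ℕ} (he : Function.Injective e) {u v : σ} {τ : Finset σ}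
    (huv : u ≠ v) (hu : u ∉ τ) (hv : v ∉ τ) :
    koszulSign e u (insert v τ) * koszulSign e v (insert u τ) =
      -(koszulSign e u τ * koszulSign e v τ) := by
  have hne : e u ≠ e v := fun h => huv (he h)
  simp only [koszulSign, Finset.prod_insert hu, Finset.prod_insert hv]
  rcases lt_or_gt_of_ne hne with h | h
  · simp [h, h.not_gt]
  · simp [h, h.not_gt]

theorem koszulSign_swap' {e : σ → ℕ} (he : Function.Injective e) {u v : σ} {τ : Finset σ}
    (huv : u ≠ v) (hu : u ∉ τ) (hv : v ∉ τ) :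
    koszulSign e u τ * koszulSign e v (insert u τ) =
      -(koszulSign e v τ * koszulSign e u (insert v τ)) := by
  have hne : e u ≠ e v := fun h => huv (he h)
  simp only [koszulSign, Finset.prod_insert hu, Finset.prod_insert hv]
  rcases lt_or_gt_of_ne hne with h | h
  · simp [h, h.not_gt, mul_comm]
  · simp [h, h.not_gt, mul_comm]

variable [Fintype σ]

/-- The differential of the augmented chain complex of the full simplex on `σ`. -/
def simplexBoundary {A : Type*} [AddCommGroup A] (e : σ → ℕ) (G : Finset σ → A) : Finset σ → A :=
  fun τ => ∑ v ∈ τᶜ, koszulSign e v τ • G (insert v τ)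

/-- The contraction of the full simplex onto the vertex `v`. -/
def simplexCone {A : Type*} [AddCommGroup A] (e : σ → ℕ) (v : σ) (G : Finset σ → A) :
    Finset σ → A :=
  fun τ => if v ∈ τ then koszulSign e v (τ.erase v) • G (τ.erase v) else 0

/-- The full simplex is contractible: coning with `v` is a homotopy between the identity and zero.
On faces containing `v`, only the term of the boundary that inserts `v` survives; on the others,
only the cone over `τ` contributes. -/
theorem simplexBoundary_cone {A : Type*} [AddCommGroup A] {e : σ → ℕ}
    (he : Function.Injective e) (v : σ) (G : Finset σ → A) :
    simplexBoundary e (simplexCone e v G) + simplexCone e v (simplexBoundary e G) = G := by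
  funext τ
  simp only [Pi.add_apply, simplexBoundary, simplexCone]
  by_cases hv : v ∈ τ
  · obtain ⟨ρ, hρ, rfl⟩ : ∃ ρ, v ∉ ρ ∧ τ = insert v ρ :=
      ⟨τ.erase v, Finset.notMem_erase _ _, (Finset.insert_erase hv).symm⟩
    have hc : ρᶜ = insert v (insert v ρ)ᶜ := by
      ext u; simp only [Finset.mem_compl, Finset.mem_insert]; by_cases h : u = v <;> simp_all
    simp only [Finset.mem_insert_self, if_true, Finset.erase_insert hρ]
    rw [hc, Finset.sum_insert (by simp), smul_add, smul_smul, koszulSign_mul_self, one_smul,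
      add_left_comm, Finset.smul_sum, ← Finset.sum_add_distrib]
    refine (add_eq_left).2 (Finset.sum_eq_zero fun u hu => ?_)
    simp only [Finset.mem_compl, Finset.mem_insert, not_or] at hu
    have : (insert u (insert v ρ)).erase v = insert u ρ := by
      rw [Finset.insert_comm, Finset.erase_insert]
      simp [hρ, Ne.symm hu.1]
    simp only [this, Finset.mem_insert, true_or, or_true, if_true, smul_smul]
    rw [koszulSign_swap he hu.1 hu.2 hρ, ← add_smul, mul_comm (koszulSign e v ρ)]
    simp
  · rw [if_neg hv, add_zero, Finset.sum_eq_single_of_mem v (by simpa using hv)]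
    · simp [Finset.erase_insert hv, smul_smul, koszulSign_mul_self]
    · intro u _ huv
      simp [hv, Ne.symm huv]

variable {K : Type*} [Field K]

/-- The Koszul differential with coefficients in a module `M`. A chain is a function that assigns
to `τ` the coefficient of the wedge product of the basis vectors in `τ`. -/
def koszul (K : Type*) [Field K] {M : Type*} [AddCommGroup M] [Module (MvPolynomial σ K) M]
    (e : σ → ℕ) : (Finset σ → M) →ₗ[MvPolynomial σ K] (Finset σ → M) where
  toFun f τ := ∑ v ∈ τᶜ, koszulSign e v τ • (MvPolynomial.X v : MvPolynomial σ K) • f (insert v τ)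
  map_add' f g := by
    funext τ; simp [smul_add, Finset.sum_add_distrib]
  map_smul' r f := by
    funext τ
    simp only [Pi.smul_apply, RingHom.id_apply, Finset.smul_sum]
    refine Finset.sum_congr rfl fun v _ => ?_
    rw [smul_comm r (koszulSign e v τ), smul_comm r (MvPolynomial.X v : MvPolynomial σ K)]

section Module

variable {M N : Type*} [AddCommGroup M] [Module (MvPolynomial σ K) M]
  [AddCommGroup N] [Module (MvPolynomial σ K) N]

theorem koszul_apply (e : σ → ℕ) (f : Finset σ → M) (τ : Finset σ) :
    koszul K e f τ =
      ∑ v ∈ τᶜ, koszulSign e v τ • (MvPolynomial.X v : MvPolynomial σ K) • f (insert v τ) := rfl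

theorem koszul_comp (e : σ → ℕ) (φ : M →ₗ[MvPolynomial σ K] N) (f : Finset σ → M) :
    koszul K e (φ ∘ f) = φ ∘ koszul K e f := by
  funext τ
  simp [koszul_apply, map_sum]

theorem koszul_koszul {e : σ → ℕ} (he : Function.Injective e) (f : Finset σ → M) :
    koszul K e (koszul K e f) = 0 := by
  funext τ
  simp only [koszul_apply, Pi.zero_apply, Finset.smul_sum]
  rw [Finset.sum_sigma']
  -- The terms inserting `u, v` and `v, u` cancel in pairs.
  refine Finset.sum_involution (fun p _ => ⟨p.2, p.1⟩) ?_ ?_ ?_ ?_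
  · rintro ⟨u, v⟩ h
    simp only [Finset.mem_sigma, Finset.mem_compl, Finset.mem_insert, not_or] at h
    dsimp only
    rw [Finset.insert_comm v u]
    generalize f (insert u (insert v τ)) = x
    rw [smul_comm (MvPolynomial.X v : MvPolynomial σ K) (koszulSign e u (insert v τ)),
      smul_comm (MvPolynomial.X v : MvPolynomial σ K) (MvPolynomial.X u : MvPolynomial σ K) x,
      smul_comm (MvPolynomial.X u : MvPolynomial σ K) (koszulSign e v (insert u τ))]
    generalize (MvPolynomial.X u : MvPolynomial σ K) • (MvPolynomial.X v : MvPolynomial σ K) • x = y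
    rw [smul_smul, smul_smul, koszulSign_swap' he (Ne.symm h.2.1) h.1 h.2.2, ← add_smul]
    simp
  · rintro ⟨u, v⟩ h _ h'
    simp only [Finset.mem_sigma, Finset.mem_compl, Finset.mem_insert, not_or] at h
    simp only [Sigma.mk.injEq, heq_eq_eq] at h'
    exact h.2.1 h'.1
  · rintro ⟨u, v⟩ h
    simp only [Finset.mem_sigma, Finset.mem_compl, Finset.mem_insert, not_or] at h ⊢
    exact ⟨h.2.2, Ne.symm h.2.1, h.1⟩
  · rintro ⟨u, v⟩ h
    rfl

end Module

/-! ### Multigraded slices -/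

/-- The exponent vector of the squarefree monomial with support `τ`. -/
def indic (τ : Finset σ) : σ →₀ ℕ := Finsupp.equivFunOnFinite.symm fun v => if v ∈ τ then 1 else 0

theorem indic_apply (τ : Finset σ) (v : σ) : indic τ v = if v ∈ τ then 1 else 0 := rfl

theorem indic_insert {τ : Finset σ} {v : σ} (hv : v ∉ τ) :
    indic (insert v τ) = Finsupp.single v 1 + indic τ := by
  ext u
  by_cases h : u = v
  · subst h; simp [indic_apply, hv]
  · simp [indic_apply, h]

theorem degree_indic (τ : Finset σ) : (indic τ).degree = τ.card := by
  induction τ using Finset.induction_on with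
  | empty =>
    rw [Finset.card_empty, Finsupp.degree_eq_zero_iff]
    ext
    simp [indic_apply]
  | insert v τ hv ih =>
    rw [indic_insert hv, map_add, ih, Finset.card_insert_of_notMem hv]
    simp [add_comm]

/-- The part of multidegree `a` of a Koszul chain. -/
def slice (a : σ →₀ ℕ) (f : Finset σ → MvPolynomial σ K) : Finset σ → K :=
  fun τ => if indic τ ≤ a then (f τ).coeff (a - indic τ) else 0

theorem slice_add_indic (f : Finset σ → MvPolynomial σ K) (τ : Finset σ) (m : σ →₀ ℕ) :
    slice (m + indic τ) f τ = (f τ).coeff m := by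
  simp [slice]

/-- Multiplication by `X v` compensates the removal of `v` from the face, so the differential
preserves the total multidegree `m + indic τ`. In multidegree `a` the Koszul complex becomes the
part of the simplex on faces with `indic τ ≤ a`. -/
theorem slice_koszul (e : σ → ℕ) (a : σ →₀ ℕ) (f : Finset σ → MvPolynomial σ K) :
    slice a (koszul K e f) = simplexBoundary e (slice a f) := by
  funext τ
  simp only [simplexBoundary]
  by_cases h : indic τ ≤ a
  · obtain ⟨m, rfl⟩ := exists_add_of_le h
    rw [add_comm, slice_add_indic, koszul_apply, MvPolynomial.coeff_sum]
    refine Finset.sum_congr rfl fun v hv => ?_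
    rw [MvPolynomial.coeff_smul, smul_eq_mul, mul_comm, MvPolynomial.coeff_mul_X']
    congr 1
    rw [slice, indic_insert (by simpa using hv)]
    have : Finsupp.single v 1 + indic τ ≤ m + indic τ ↔ v ∈ m.support := by
      rw [add_le_add_iff_right, Finsupp.single_le_iff, Finsupp.mem_support_iff]
      omega
    simp only [this]
    congr 1
    rw [add_tsub_add_eq_tsub_right]
  · rw [slice, if_neg h]
    refine (Finset.sum_eq_zero fun v hv => ?_).symm
    have hv' : v ∉ τ := by simpa using hv
    have : ¬ indic (insert v τ) ≤ a := fun h' => h (le_trans (by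
      rw [indic_insert hv']; exact le_add_self) h')
    simp [slice, this]

/-- If the contraction vertices can be chosen compatibly with the conditions `U` on a cycle and `V`
on a chain that bounds it, then every Koszul cycle satisfying `U` bounds a chain satisfying `V`. -/
theorem exists_koszul_eq {e : σ → ℕ} (he : Function.Injective e) {U V : (σ →₀ ℕ) → Prop} {q : ℕ}
    (hUV : ∀ (a m : σ →₀ ℕ) (ρ : Finset σ), ρ.card = q → m + indic ρ = a → U m →
      ∃ v, a v ≠ 0 ∧ ∀ (ρ' : Finset σ) (b : σ →₀ ℕ), ρ'.card = q → v ∉ ρ' →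
        b + Finsupp.single v 1 + indic ρ' = a → U (b + Finsupp.single v 1) → V b)
    (f : Finset σ → MvPolynomial σ K)
    (hf : ∀ τ m, (f τ).coeff m ≠ 0 → τ.card = q ∧ U m) (hcyc : koszul K e f = 0) :
    ∃ g : Finset σ → MvPolynomial σ K, koszul K e g = f ∧
      ∀ τ m, (g τ).coeff m ≠ 0 → τ.card = q + 1 ∧ V m ∧
        ∃ ρ m', (f ρ).coeff m' ≠ 0 ∧ m' + indic ρ = m + indic τ := by
  classical
  let A : Finset (σ →₀ ℕ) := Finset.univ.biUnion fun τ => (f τ).support.image (· + indic τ)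
  have hA : ∀ a, a ∈ A ↔ ∃ τ m, (f τ).coeff m ≠ 0 ∧ m + indic τ = a := by
    intro a; simp [A, MvPolynomial.mem_support_iff]
  have hch : ∀ a ∈ A, ∃ v, a v ≠ 0 ∧ ∀ (ρ' : Finset σ) (b : σ →₀ ℕ), ρ'.card = q → v ∉ ρ' →
        b + Finsupp.single v 1 + indic ρ' = a → U (b + Finsupp.single v 1) → V b := by
    intro a ha
    obtain ⟨τ, m, hm, rfl⟩ := (hA a).1 ha
    obtain ⟨h1, h2⟩ := hf τ m hm
    exact hUV _ m τ h1 rfl h2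
  -- Without variables no contraction vertex exists, so `f` must vanish; this case is separated
  -- because a total choice of vertices needs a default.
  rcases isEmpty_or_nonempty σ with hσ | hσ
  · have hf0 : f = 0 := by
      funext τ
      ext m
      by_contra hne
      obtain ⟨v, -⟩ := hch _ ((hA _).2 ⟨τ, m, hne, rfl⟩)
      exact hσ.elim v
    exact ⟨0, by rw [map_zero, hf0], fun τ m h => absurd (MvPolynomial.coeff_zero m) h⟩
  choose! w hw0 hw using hch
  have hsl : ∀ a, a ∉ A → slice a f = 0 := by
    intro a ha
    funext τ
    rw [slice]
    split_ifs with h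
    · by_contra hne
      exact ha ((hA a).2 ⟨τ, _, hne, tsub_add_cancel_of_le h⟩)
    · rfl
  -- the contraction of each slice is supported in the same multidegree
  have hcone : ∀ a ∈ A, ∀ τ, simplexCone e (w a) (slice a f) τ ≠ 0 →
      w a ∈ τ ∧ indic τ ≤ a ∧ (f (τ.erase (w a))).coeff (a - indic (τ.erase (w a))) ≠ 0 ∧
        indic (τ.erase (w a)) ≤ a := by
    intro a ha τ hne
    rw [simplexCone] at hne
    have hmem : w a ∈ τ := by by_contra h; simp [h] at hne
    rw [if_pos hmem, slice] at hne
    have hle : indic (τ.erase (w a)) ≤ a := by by_contra h; simp [h] at hne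
    rw [if_pos hle] at hne
    refine ⟨hmem, ?_, fun h => hne (by rw [h, smul_zero]), hle⟩
    -- The face stays admissible after adding `w a` because `w a` has positive exponent in `a`.
    intro u
    by_cases hu : u = w a
    · have := hw0 a ha
      rw [indic_apply, hu]
      split_ifs
      omega
    · have := hle u
      rw [indic_apply] at this ⊢
      simpa [hu] using this
  let g : Finset σ → MvPolynomial σ K := fun τ => ∑ a ∈ A,
    if indic τ ≤ a then MvPolynomial.monomial (a - indic τ) (simplexCone e (w a) (slice a f) τ)
      else 0
  have hg : ∀ τ m, (g τ).coeff m =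
      if m + indic τ ∈ A then simplexCone e (w (m + indic τ)) (slice (m + indic τ) f) τ else 0 := by
    intro τ m
    simp only [g, MvPolynomial.coeff_sum]
    have key : ∀ a ∈ A, (if indic τ ≤ a then
        MvPolynomial.monomial (a - indic τ) (simplexCone e (w a) (slice a f) τ) else 0).coeff m =
        if a = m + indic τ then simplexCone e (w a) (slice a f) τ else 0 := by
      intro a _
      by_cases h : indic τ ≤ a
      · rw [if_pos h, MvPolynomial.coeff_monomial]
        have : a - indic τ = m ↔ a = m + indic τ := tsub_eq_iff_eq_add_of_le h
        simp only [this]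
      · rw [if_neg h, if_neg (fun h' => h (by rw [h']; exact le_add_self)), MvPolynomial.coeff_zero]
    rw [Finset.sum_congr rfl key, Finset.sum_ite_eq']
  refine ⟨g, ?_, ?_⟩
  · have hs : ∀ a, slice a (koszul K e g) = slice a f := by
      intro a
      rw [slice_koszul]
      by_cases ha : a ∈ A
      · have : slice a g = simplexCone e (w a) (slice a f) := by
          funext τ
          rw [slice]
          split_ifs with h
          · rw [hg, tsub_add_cancel_of_le h, if_pos ha]
          · by_contra hne
            exact h (hcone a ha τ (Ne.symm hne)).2.1
        rw [this]
        conv_rhs => rw [← simplexBoundary_cone he (w a) (slice a f)]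
        rw [← slice_koszul, hcyc]
        have : simplexCone e (w a) (slice a (0 : Finset σ → MvPolynomial σ K)) = 0 := by
          funext τ; simp [simplexCone, slice]
        rw [this, add_zero]
      · rw [hsl a ha]
        have : slice a g = 0 := by
          funext τ
          rw [slice]
          split_ifs with h
          · rw [hg, tsub_add_cancel_of_le h, if_neg ha]; rfl
          · rfl
        rw [this]
        funext τ; simp [simplexBoundary]
    funext τ
    ext m
    rw [← slice_add_indic, hs, slice_add_indic]
  · intro τ m hne
    rw [hg] at hne
    have ha : m + indic τ ∈ A := by by_contra h; simp [h] at hne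
    rw [if_pos ha] at hne
    obtain ⟨h1, -, h3, h4⟩ := hcone _ ha τ hne
    set v := w (m + indic τ) with hv
    have hins : indic τ = Finsupp.single v 1 + indic (τ.erase v) := by
      rw [← indic_insert (Finset.notMem_erase _ _), Finset.insert_erase h1]
    have hm : m + indic τ - indic (τ.erase v) = m + Finsupp.single v 1 := by
      rw [hins, ← add_assoc, add_tsub_cancel_right]
    rw [hm] at h3
    obtain ⟨hq, hU⟩ := hf _ _ h3
    refine ⟨?_, hw _ ha (τ.erase v) m hq (Finset.notMem_erase _ _) ?_ hU, _, _, h3, ?_⟩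
    · rw [← Finset.card_erase_add_one h1, hq]
    · rw [add_assoc]
      exact congrArg (m + ·) hins.symm
    · rw [hins, add_assoc]

end Koszul

/-! ### A double complex argument -/

/-- A double complex with exact rows `⋯ → A q 1 → A q 0 → N q → 0`, all of whose columns except
the last one (that of `N`) are exact in positive degrees. If the last column is exact at `P`, then
so is the complex of the cokernels at the ends of the columns. -/
theorem exists_add_of_exact_rows_of_exact_columns {X : ℕ → Type*} {Y : Type*}
    [∀ p, AddCommGroup (X p)] [AddCommGroup Y]
    (A : ℕ → ∀ p, AddSubgroup (X p)) (N : ℕ → AddSubgroup Y)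
    (δ : ∀ p, X p →+ X p) (δY : Y →+ Y) (d : ∀ p, X (p + 1) →+ X p) (η : X 0 →+ Y)
    (hδ : ∀ q p x, x ∈ A (q + 1) p → δ p x ∈ A q p) (hδδ : ∀ p x, δ p (δ p x) = 0)
    (hdδ : ∀ p x, d p (δ (p + 1) x) = δ p (d p x)) (hηδ : ∀ x, η (δ 0 x) = δY (η x))
    (hdd : ∀ p x, d p (d (p + 1) x) = 0) (hηd : ∀ x, η (d 0 x) = 0)
    (hdA : ∀ q p x, x ∈ A q (p + 1) → d p x ∈ A q p) (hηN : ∀ q x, x ∈ A q 0 → η x ∈ N q)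
    (exact_d : ∀ q p x, x ∈ A q (p + 1) → d p x = 0 → ∃ y ∈ A q (p + 2), d (p + 1) y = x)
    (exact_η : ∀ q x, x ∈ A q 0 → η x = 0 → ∃ y ∈ A q 1, d 0 y = x)
    (surj : ∀ q x, x ∈ N q → ∃ y ∈ A q 0, η y = x)
    (col : ∀ q p x, x ∈ A (q + 1) p → δ p x = 0 → ∃ y ∈ A (q + 2) p, δ p y = x)
    (P : ℕ) (hN : ∀ x ∈ N P, δY x = 0 → ∃ y ∈ N (P + 1), δY y = x) :
    (∀ z ∈ A P 0, δY (η z) = 0 → ∃ y ∈ A P 1, ∃ y' ∈ A (P + 1) 0, z = d 0 y + δ 0 y') ∧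
    ∀ p q, q + (p + 1) = P → ∀ z ∈ A q (p + 1), ∀ z' ∈ A (q + 1) p, d p z = δ p z' →
      ∃ y ∈ A q (p + 2), ∃ y' ∈ A (q + 1) (p + 1), z = d (p + 1) y + δ (p + 1) y' := by
  have base : ∀ z ∈ A P 0, δY (η z) = 0 →
      ∃ y ∈ A P 1, ∃ y' ∈ A (P + 1) 0, z = d 0 y + δ 0 y' := by
    intro z hz h
    obtain ⟨t, ht, ht'⟩ := hN _ (hηN _ _ hz) h
    obtain ⟨y, hy, rfl⟩ := surj _ _ ht
    obtain ⟨y', hy', h'⟩ := exact_η P (z - δ 0 y) (sub_mem hz (hδ _ _ _ hy)) (by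
      rw [map_sub, hηδ, ht', sub_self])
    exact ⟨y', hy', y, hy, by rw [h', sub_add_cancel]⟩
  refine ⟨base, fun p => ?_⟩
  induction p with
  | zero =>
    intro q hq z hz z' hz' h
    obtain rfl : q + 1 = P := hq
    obtain ⟨y, hy, y', hy', rfl⟩ := base z' hz' (by rw [← hηδ, ← h, hηd])
    rw [map_add, hδδ, add_zero, ← hdδ] at h
    obtain ⟨x, hx, h'⟩ := exact_d q 0 (z - δ 1 y) (sub_mem hz (hδ _ _ _ hy)) (by
      rw [map_sub, h, sub_self])
    exact ⟨x, hx, y, hy, by rw [h', sub_add_cancel]⟩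
  -- Staircase step: `d z'` is a `δ`-cycle, hence a `δ`-boundary by column exactness, and the
  -- induction hypothesis applies to `z'`. Writing `z' = d y + δ y'` makes `z - δ y` a `d`-cycle,
  -- which lifts along the exact row.
  | succ p ih =>
    intro q hq z hz z' hz' h
    obtain ⟨z'', hz'', h''⟩ := col q p (d p z') (hdA _ _ _ hz') (by rw [← hdδ, ← h, hdd])
    obtain ⟨y, hy, y', hy', rfl⟩ := ih (q + 1) (by omega) z' hz' z'' hz'' h''.symm
    rw [map_add, hδδ, add_zero, ← hdδ] at h
    obtain ⟨x, hx, h'⟩ := exact_d q (p + 1) (z - δ (p + 2) y) (sub_mem hz (hδ _ _ _ hy)) (by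
      rw [map_sub, h, sub_self])
    exact ⟨x, hx, y, hy, by rw [h', sub_add_cancel]⟩

/-! ### Graded free modules -/

section GradedFree

variable {K : Type*} [Field K] {σ : Type*} {B B' : Type*}

/-- The elements of degree `k` of the graded free module with basis `B`. -/
def IsHomogeneousOf (deg : B → ℤ) (k : ℤ) (x : B →₀ MvPolynomial σ K) : Prop :=
  ∀ b m, (m.degree : ℤ) + deg b ≠ k → (x b).coeff m = 0

open Classical in
/-- The component of degree `k` of an element of a graded free module. -/
def gradedComponent (deg : B → ℤ) (k : ℤ) (x : B →₀ MvPolynomial σ K) :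
    B →₀ MvPolynomial σ K :=
  Finsupp.onFinset x.support
    -- The guard prevents `toNat` from sending a negative degree to the component of degree `0`.
    (fun b => if 0 ≤ k - deg b then MvPolynomial.homogeneousComponent (k - deg b).toNat (x b) else 0)
    (fun b h => by
      by_contra hb
      rw [Finsupp.notMem_support_iff] at hb
      simp [hb] at h)

open Classical in
theorem coeff_gradedComponent (deg : B → ℤ) (k : ℤ) (x : B →₀ MvPolynomial σ K) (b : B)
    (m : σ →₀ ℕ) : (gradedComponent deg k x b).coeff m =
      if (m.degree : ℤ) + deg b = k then (x b).coeff m else 0 := by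
  rw [gradedComponent, Finsupp.onFinset_apply]
  split_ifs with h1 h2 h2
  · rw [MvPolynomial.coeff_homogeneousComponent, if_pos (by omega)]
  · rw [MvPolynomial.coeff_homogeneousComponent, if_neg (by omega)]
  · omega
  · rw [MvPolynomial.coeff_zero]

theorem isHomogeneousOf_gradedComponent (deg : B → ℤ) (k : ℤ) (x : B →₀ MvPolynomial σ K) :
    IsHomogeneousOf deg k (gradedComponent deg k x) := by
  classical
  intro b m h
  rw [coeff_gradedComponent, if_neg h]

theorem IsHomogeneousOf.gradedComponent_eq {deg : B → ℤ} {k : ℤ} {x : B →₀ MvPolynomial σ K}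
    (h : IsHomogeneousOf deg k x) : gradedComponent deg k x = x := by
  classical
  ext b m
  rw [coeff_gradedComponent]
  split_ifs with h'
  · rfl
  · rw [h b m h']

theorem gradedComponent_add (deg : B → ℤ) (k : ℤ) (x y : B →₀ MvPolynomial σ K) :
    gradedComponent deg k (x + y) = gradedComponent deg k x + gradedComponent deg k y := by
  classical
  ext b m
  simp only [Finsupp.add_apply, MvPolynomial.coeff_add, coeff_gradedComponent]
  split_ifs <;> simp

theorem gradedComponent_zero (deg : B → ℤ) (k : ℤ) :
    gradedComponent deg k (0 : B →₀ MvPolynomial σ K) = 0 := by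
  classical
  ext b m
  simp [coeff_gradedComponent]

theorem IsHomogeneousOf.gradedComponent_of_ne {deg : B → ℤ} {k l : ℤ} {x : B →₀ MvPolynomial σ K}
    (h : IsHomogeneousOf deg l x) (hkl : l ≠ k) : gradedComponent deg k x = 0 := by
  classical
  ext b m
  rw [coeff_gradedComponent]
  split_ifs with h'
  · rw [h b m (by omega)]; simp
  · simp

section Map

variable {deg : B → ℤ} {deg' : B' → ℤ}

theorem map_gradedComponent
    (φ : (B' →₀ MvPolynomial σ K) →ₗ[MvPolynomial σ K] (B →₀ MvPolynomial σ K))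
    (hφ : ∀ (b' : B') (b : B) (m : σ →₀ ℕ), (φ (Finsupp.single b' 1) b).coeff m ≠ 0 →
      deg' b' = deg b + (m.degree : ℤ))
    (k : ℤ) (y : B' →₀ MvPolynomial σ K) :
    φ (gradedComponent deg' k y) = gradedComponent deg k (φ y) := by
  classical
  induction y using Finsupp.induction_linear with
  | zero => simp [gradedComponent_zero]
  | add x y hx hy => rw [gradedComponent_add, map_add, hx, hy, map_add, gradedComponent_add]
  | single b f =>
    induction f using MvPolynomial.induction_on' with
    | add p q hp hq =>
      rw [Finsupp.single_add, gradedComponent_add, map_add, hp, hq, map_add, gradedComponent_add]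
    | monomial m r =>
      have h1 : IsHomogeneousOf deg' ((m.degree : ℤ) + deg' b)
          (Finsupp.single b (MvPolynomial.monomial m r)) := by
        intro b₁ m₁ h
        by_cases hb : b = b₁
        · subst hb
          rw [Finsupp.single_eq_same, MvPolynomial.coeff_monomial, if_neg]
          rintro rfl
          exact h rfl
        · rw [Finsupp.single_eq_of_ne (Ne.symm hb), MvPolynomial.coeff_zero]
      have h2 : IsHomogeneousOf deg ((m.degree : ℤ) + deg' b)
          (φ (Finsupp.single b (MvPolynomial.monomial m r))) := by
        intro b₁ m₁ h
        have : Finsupp.single b (MvPolynomial.monomial m r) =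
            (MvPolynomial.monomial m r) • Finsupp.single b (1 : MvPolynomial σ K) := by simp
        rw [this, map_smul, Finsupp.smul_apply, smul_eq_mul, MvPolynomial.coeff_monomial_mul']
        split_ifs with hm
        · by_contra hne
          have h3 := hφ b b₁ (m₁ - m) (right_ne_zero_of_mul hne)
          obtain ⟨m₂, rfl⟩ := exists_add_of_le hm
          rw [add_tsub_cancel_left] at h3
          apply h
          rw [map_add, h3]
          push_cast
          ring
        · rfl
      by_cases hk : (m.degree : ℤ) + deg' b = k
      · subst hk
        rw [h1.gradedComponent_eq, h2.gradedComponent_eq]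
      · rw [h1.gradedComponent_of_ne hk, h2.gradedComponent_of_ne hk, map_zero]

theorem IsHomogeneousOf.map
    (φ : (B' →₀ MvPolynomial σ K) →ₗ[MvPolynomial σ K] (B →₀ MvPolynomial σ K))
    (hφ : ∀ (b' : B') (b : B) (m : σ →₀ ℕ), (φ (Finsupp.single b' 1) b).coeff m ≠ 0 →
      deg' b' = deg b + (m.degree : ℤ))
    {k : ℤ} {y : B' →₀ MvPolynomial σ K} (h : IsHomogeneousOf deg' k y) :
    IsHomogeneousOf deg k (φ y) := by
  rw [← h.gradedComponent_eq, map_gradedComponent φ hφ]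
  exact isHomogeneousOf_gradedComponent _ _ _

/-- A homogeneous map commutes with taking components, so any preimage can be replaced by its
component of degree `k`. Exactness of the resolution thus passes to each internal degree. -/
theorem exists_isHomogeneousOf_map_eq
    (φ : (B' →₀ MvPolynomial σ K) →ₗ[MvPolynomial σ K] (B →₀ MvPolynomial σ K))
    (hφ : ∀ (b' : B') (b : B) (m : σ →₀ ℕ), (φ (Finsupp.single b' 1) b).coeff m ≠ 0 →
      deg' b' = deg b + (m.degree : ℤ))
    {k : ℤ} {y : B' →₀ MvPolynomial σ K}
    (h : IsHomogeneousOf deg k (φ y)) : ∃ y', IsHomogeneousOf deg' k y' ∧ φ y' = φ y :=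
  ⟨gradedComponent deg' k y, isHomogeneousOf_gradedComponent _ _ _, by
    rw [map_gradedComponent φ hφ, h.gradedComponent_eq]⟩

end Map

end GradedFree

/-! ### Vanishing of Tor for monomial ideals -/

section TorVanishing

variable {K : Type*} [Field K] {σ : Type*}

theorem IsMonomialIdeal.monomial_mem {I : Ideal (MvPolynomial σ K)} (hI : IsMonomialIdeal I)
    {f : MvPolynomial σ K} (hf : f ∈ I) {m : σ →₀ ℕ} (hm : f.coeff m ≠ 0) :
    MvPolynomial.monomial m (1 : K) ∈ I := by
  obtain ⟨s, rfl⟩ := hI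
  rw [MvPolynomial.mem_ideal_span_monomial_image] at hf ⊢
  intro xi hxi
  obtain rfl : xi = m := by
    have := MvPolynomial.support_monomial_subset hxi
    simpa using this
  exact hf _ (MvPolynomial.mem_support_iff.2 hm)

theorem mem_of_forall_monomial_mem {I : Ideal (MvPolynomial σ K)} {f : MvPolynomial σ K}
    (h : ∀ m, f.coeff m ≠ 0 → MvPolynomial.monomial m (1 : K) ∈ I) : f ∈ I := by
  rw [f.as_sum]
  refine sum_mem fun m hm => ?_
  rw [← mul_one (f.coeff m), ← MvPolynomial.C_mul_monomial]
  exact I.mul_mem_left _ (h m (MvPolynomial.mem_support_iff.1 hm))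

/-! ### Bigraded Koszul chains -/

section Chains

variable {B B' : Type*}

/-- The Koszul chains of homological degree `q` and internal degree `j` with coefficients in the
graded free module with basis `B`. -/
def koszulPart (K : Type*) [Field K] (σ : Type*) (deg : B → ℤ) (j : ℤ) (q : ℕ) :
    AddSubgroup (Finset σ → (B →₀ MvPolynomial σ K)) where
  carrier := {f | ∀ τ, (τ.card ≠ q → f τ = 0) ∧ IsHomogeneousOf deg (j - q) (f τ)}
  zero_mem' τ := ⟨fun _ => rfl, fun b m _ => rfl⟩
  add_mem' {f g} hf hg τ := by
    refine ⟨fun h => ?_, fun b m h => ?_⟩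
    · rw [Pi.add_apply, (hf τ).1 h, (hg τ).1 h, add_zero]
    · rw [Pi.add_apply, Finsupp.add_apply, MvPolynomial.coeff_add, (hf τ).2 b m h,
        (hg τ).2 b m h, add_zero]
  neg_mem' {f} hf τ := by
    refine ⟨fun h => ?_, fun b m h => ?_⟩
    · rw [Pi.neg_apply, (hf τ).1 h, neg_zero]
    · rw [Pi.neg_apply, Finsupp.neg_apply, MvPolynomial.coeff_neg, (hf τ).2 b m h, neg_zero]

/-- The Koszul chains of homological degree `q` and internal degree `j` with coefficients in the
monomial ideal `I`. -/
def koszulIdealPart (I : Ideal (MvPolynomial σ K)) (j : ℤ) (q : ℕ) :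
    AddSubgroup (Finset σ → MvPolynomial σ K) where
  carrier := {f | ∀ τ, (τ.card ≠ q → f τ = 0) ∧
    (∀ m, (m.degree : ℤ) ≠ j - q → (f τ).coeff m = 0) ∧ f τ ∈ I}
  zero_mem' τ := ⟨fun _ => rfl, fun m _ => rfl, I.zero_mem⟩
  add_mem' {f g} hf hg τ := by
    refine ⟨fun h => ?_, fun m h => ?_, I.add_mem (hf τ).2.2 (hg τ).2.2⟩
    · rw [Pi.add_apply, (hf τ).1 h, (hg τ).1 h, add_zero]
    · rw [Pi.add_apply, MvPolynomial.coeff_add, (hf τ).2.1 m h, (hg τ).2.1 m h, add_zero]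
  neg_mem' {f} hf τ := by
    refine ⟨fun h => ?_, fun m h => ?_, I.neg_mem (hf τ).2.2⟩
    · rw [Pi.neg_apply, (hf τ).1 h, neg_zero]
    · rw [Pi.neg_apply, MvPolynomial.coeff_neg, (hf τ).2.1 m h, neg_zero]

theorem comp_mem_koszulPart {deg : B → ℤ} {deg' : B' → ℤ}
    (φ : (B' →₀ MvPolynomial σ K) →ₗ[MvPolynomial σ K] (B →₀ MvPolynomial σ K))
    (hφ : ∀ (b' : B') (b : B) (m : σ →₀ ℕ), (φ (Finsupp.single b' 1) b).coeff m ≠ 0 →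
      deg' b' = deg b + (m.degree : ℤ))
    {j : ℤ} {q : ℕ} {f : Finset σ → (B' →₀ MvPolynomial σ K)}
    (hf : f ∈ koszulPart K σ deg' j q) : φ ∘ f ∈ koszulPart K σ deg j q := by
  intro τ
  refine ⟨fun h => ?_, (hf τ).2.map φ hφ⟩
  rw [Function.comp_apply, (hf τ).1 h, map_zero]

theorem exists_comp_eq_of_forall_mem_range {deg : B → ℤ} {deg' : B' → ℤ}
    (φ : (B' →₀ MvPolynomial σ K) →ₗ[MvPolynomial σ K] (B →₀ MvPolynomial σ K))
    (hφ : ∀ (b' : B') (b : B) (m : σ →₀ ℕ), (φ (Finsupp.single b' 1) b).coeff m ≠ 0 →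
      deg' b' = deg b + (m.degree : ℤ))
    {j : ℤ} {q : ℕ} {f : Finset σ → (B →₀ MvPolynomial σ K)}
    (hf : f ∈ koszulPart K σ deg j q) (hr : ∀ τ, f τ ∈ Set.range φ) :
    ∃ g ∈ koszulPart K σ deg' j q, φ ∘ g = f := by
  classical
  have key : ∀ τ, ∃ y, IsHomogeneousOf deg' (j - q) y ∧ φ y = f τ := by
    intro τ
    obtain ⟨y, hy⟩ := hr τ
    rw [← hy]
    refine exists_isHomogeneousOf_map_eq φ hφ ?_
    rw [hy]
    exact (hf τ).2
  choose y hy hy' using key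
  refine ⟨fun τ => if τ.card = q then y τ else 0, fun τ => ⟨fun h => if_neg h, ?_⟩, ?_⟩
  · dsimp only
    split_ifs
    · exact hy τ
    · exact fun b m _ => rfl
  · funext τ
    rw [Function.comp_apply]
    split_ifs with h
    · exact hy' τ
    · rw [map_zero, (hf τ).1 h]

variable [Fintype σ] [DecidableEq σ]

theorem koszul_mem_koszulPart (e : σ → ℕ) {deg : B → ℤ} {j : ℤ} {q : ℕ}
    {f : Finset σ → (B →₀ MvPolynomial σ K)} (hf : f ∈ koszulPart K σ deg j (q + 1)) :
    koszul K e f ∈ koszulPart K σ deg j q := by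
  intro τ
  rw [koszul_apply]
  refine ⟨fun h => Finset.sum_eq_zero fun v hv => ?_, fun b m h => ?_⟩
  · rw [(hf (insert v τ)).1, smul_zero, smul_zero]
    rw [Finset.card_insert_of_notMem (by simpa using hv)]
    omega
  · rw [Finsupp.finsetSum_apply, MvPolynomial.coeff_sum]
    refine Finset.sum_eq_zero fun v _ => ?_
    rw [Finsupp.smul_apply, MvPolynomial.coeff_smul, Finsupp.smul_apply, smul_eq_mul, mul_comm,
      MvPolynomial.coeff_mul_X']
    split_ifs with hv
    · rw [(hf (insert v τ)).2 b, smul_zero]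
      intro h'
      apply h
      have : (m - Finsupp.single v 1).degree + 1 = m.degree := by
        have h1 : Finsupp.single v 1 ≤ m := by
          rw [Finsupp.single_le_iff]
          exact Nat.one_le_iff_ne_zero.2 (Finsupp.mem_support_iff.1 hv)
        conv_rhs => rw [← tsub_add_cancel_of_le h1]
        rw [map_add]
        simp
      push_cast at h'
      omega
    · rw [smul_zero]

/-- The Koszul complex of a graded free module is exact in positive degrees, and in degree `0` at
the elements without constant coefficients. -/
theorem exists_koszul_eq_of_free {e : σ → ℕ} (he : Function.Injective e) {deg : B → ℤ} {j : ℤ}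
    {q : ℕ} {f : Finset σ → (B →₀ MvPolynomial σ K)} (hf : f ∈ koszulPart K σ deg j q)
    (h0 : q = 0 → ∀ b, (f ∅ b).coeff 0 = 0) (hcyc : koszul K e f = 0) :
    ∃ g ∈ koszulPart K σ deg j (q + 1), koszul K e g = f := by
  classical
  have key : ∀ b, ∃ g : Finset σ → MvPolynomial σ K, koszul K e g = (fun τ => f τ b) ∧
      ∀ τ m, (g τ).coeff m ≠ 0 → τ.card = q + 1 ∧ True ∧
        ∃ ρ m', (f ρ b).coeff m' ≠ 0 ∧ m' + indic ρ = m + indic τ := by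
    intro b
    -- Without a constant term in homological degree `0`, every occurring multidegree is nonzero,
    -- and any variable of positive exponent serves as contraction vertex.
    refine exists_koszul_eq he (U := fun m => q = 0 → m ≠ 0) (V := fun _ => True) ?_ _ ?_ ?_
    · rintro a m ρ hρ rfl hm
      have : m + indic ρ ≠ 0 := by
        intro h
        have h1 := congrArg Finsupp.degree h
        rw [map_add, degree_indic, hρ, map_zero] at h1
        refine hm (by omega) ((Finsupp.degree_eq_zero_iff m).1 (by omega))
      obtain ⟨v, hv⟩ := DFunLike.ne_iff.1 this
      exact ⟨v, hv, fun _ _ _ _ _ _ => trivial⟩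
    · intro τ m hm
      have hτ : τ.card = q := by
        by_contra h
        rw [(hf τ).1 h] at hm
        exact hm rfl
      refine ⟨hτ, ?_⟩
      rintro rfl rfl
      rw [Finset.card_eq_zero] at hτ
      subst hτ
      exact hm (h0 rfl b)
    · have := koszul_comp (K := K) e (Finsupp.lapply b) f
      rw [hcyc] at this
      exact this.trans rfl
  choose g hg hg' using key
  let T : Finset B := Finset.univ.biUnion fun τ => (f τ).support
  -- The chosen preimages have finite support in `b`, since a preimage only has multidegrees
  -- occurring in its cycle and so vanishes where `f` does.
  have hT : ∀ b τ, g b τ ≠ 0 → b ∈ T := by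
    intro b τ h
    obtain ⟨m, hm⟩ := MvPolynomial.ne_zero_iff.1 h
    obtain ⟨-, -, ρ, m', h', -⟩ := hg' b τ m hm
    simp only [T, Finset.mem_biUnion, Finset.mem_univ, true_and, Finsupp.mem_support_iff]
    exact ⟨ρ, fun h => h' (by rw [h, MvPolynomial.coeff_zero])⟩
  let G : Finset σ → (B →₀ MvPolynomial σ K) := fun τ =>
    Finsupp.onFinset T (fun b => g b τ) (fun b hb => hT b τ hb)
  refine ⟨G, fun τ => ⟨fun h => ?_, fun b m h => ?_⟩, ?_⟩
  · ext b m
    by_contra hne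
    exact h (hg' b τ m hne).1
  · by_contra hne
    obtain ⟨hτ, -, ρ, m', h', h''⟩ := hg' b τ m hne
    apply h'
    by_cases hρ : ρ.card = q
    · apply (hf ρ).2
      intro h3
      apply h
      have h1 := congrArg Finsupp.degree h''
      rw [map_add, map_add, degree_indic, degree_indic] at h1
      push_cast
      omega
    · rw [(hf ρ).1 hρ]
      rfl
  · funext τ
    ext1 b
    have h1 := congrFun (koszul_comp (K := K) e (Finsupp.lapply b) G) τ
    have h2 : (Finsupp.lapply b : (B →₀ MvPolynomial σ K) →ₗ[MvPolynomial σ K] _) ∘ G = g b := rfl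
    rw [h2, hg] at h1
    exact h1.symm

end Chains

/-! ### Comparison of Tor with Koszul homology -/

namespace GradedFreeResolution

variable {I : Ideal (MvPolynomial σ K)} (F : GradedFreeResolution I)

/-- Reduction of an element of a free module modulo the variables. -/
def reduceConst {B : Type*} (x : B →₀ MvPolynomial σ K) : B →₀ K :=
  x.mapRange MvPolynomial.constantCoeff (map_zero _)

theorem dBar_reduceConst (p : ℕ) (x : F.B (p + 1) →₀ MvPolynomial σ K) :
    F.dBar p (reduceConst x) = reduceConst (F.d p x) := by
  induction x using Finsupp.induction_linear with
  | zero => simp [reduceConst]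
  | add x y hx hy =>
    have h : ∀ {B : Type} (x y : B →₀ MvPolynomial σ K),
        reduceConst (x + y) = reduceConst x + reduceConst y :=
      fun x y => Finsupp.mapRange_add (fun _ _ => map_add _ _ _) _ _
    rw [h, map_add, hx, hy, map_add, h]
  | single b f =>
    have h : Finsupp.single b f = f • Finsupp.single b (1 : MvPolynomial σ K) := by simp
    rw [h, map_smul, ← h]
    simp only [reduceConst, Finsupp.mapRange_single, dBar, Finsupp.linearCombination_single]
    ext b'
    simp

variable [Fintype σ] [DecidableEq σ]

/-- A combinatorial criterion for the vanishing of `Tor_p(K, I)_j` for a monomial ideal `I`: in every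
multidegree `a` of total degree `j`, some variable `v` is a cone point for the upper Koszul complex
in dimension `p`. -/
theorem cycles_le_boundaries (hI : IsMonomialIdeal I) {p : ℕ} {j : ℤ}
    (hcone : ∀ a : σ →₀ ℕ, (a.degree : ℤ) = j → ∃ v, a v ≠ 0 ∧
      ∀ (ρ : Finset σ) (b : σ →₀ ℕ), ρ.card = p → v ∉ ρ → b + Finsupp.single v 1 + indic ρ = a →
        MvPolynomial.monomial (b + Finsupp.single v 1) (1 : K) ∈ I →
          MvPolynomial.monomial b (1 : K) ∈ I) :
    F.cycles p j ≤ F.boundaries p j := by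
  classical
  obtain ⟨e, he⟩ : ∃ e : σ → ℕ, Function.Injective e :=
    ⟨fun v => Fintype.equivFin σ v, fun u v h => (Fintype.equivFin σ).injective (Fin.ext h)⟩
  -- the augmentation as a homogeneous map between graded free modules
  let ε : (F.B 0 →₀ MvPolynomial σ K) →ₗ[MvPolynomial σ K] (Unit →₀ MvPolynomial σ K) :=
    (Finsupp.lsingle ()).comp F.aug
  have hε : ∀ (b' : F.B 0) (b : Unit) (m : σ →₀ ℕ), (ε (Finsupp.single b' 1) b).coeff m ≠ 0 →
      F.deg 0 b' = (0 : ℤ) + (m.degree : ℤ) := by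
    intro b' b m h
    rw [zero_add]
    refine F.homogeneous_aug b' m ?_
    simpa [ε] using h
  have haug : ∀ x, F.aug x ∈ I := fun x => by
    have := LinearMap.mem_range_self F.aug x
    rwa [F.range_aug] at this
  have hsingle : ∀ q (x : Finset σ → MvPolynomial σ K), x ∈ koszulIdealPart I j q →
      (fun τ => Finsupp.single () (x τ)) ∈ koszulPart K σ (fun _ : Unit => (0 : ℤ)) j q := by
    intro q x hx τ
    refine ⟨fun h => ?_, fun b m h => ?_⟩
    · dsimp only
      rw [(hx τ).1 h, Finsupp.single_zero]
    · simpa using (hx τ).2.1 m (by simpa using h)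
  obtain ⟨h0, h1⟩ := exists_add_of_exact_rows_of_exact_columns
    (X := fun p => Finset σ → (F.B p →₀ MvPolynomial σ K)) (Y := Finset σ → MvPolynomial σ K)
    (fun q p => koszulPart K σ (F.deg p) j q) (koszulIdealPart I j)
    (fun _ => (koszul K e).toAddMonoidHom) (koszul K e).toAddMonoidHom
    (fun p => ((F.d p).compLeft (Finset σ)).toAddMonoidHom)
    ((F.aug).compLeft (Finset σ)).toAddMonoidHom
    (fun q p x hx => koszul_mem_koszulPart e hx) (fun p x => koszul_koszul he x)
    (fun p x => (koszul_comp e (F.d p) x).symm) (fun x => (koszul_comp e F.aug x).symm)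
    (fun p x => funext fun τ => (F.exact_d p).apply_apply_eq_zero (x τ))
    (fun x => funext fun τ => F.exact_aug.apply_apply_eq_zero (x τ))
    (fun q p x hx => comp_mem_koszulPart (F.d p) (F.homogeneous_d p) hx)
    (fun q x hx τ => by
      have := comp_mem_koszulPart ε hε hx τ
      refine ⟨fun h => ?_, fun m h => ?_, haug _⟩
      · have h2 := DFunLike.congr_fun (this.1 h) ()
        simpa [ε] using h2
      · have h2 := this.2 () m (by simpa using h)
        simpa [ε] using h2)
    (fun q p x hx h => exists_comp_eq_of_forall_mem_range _ (F.homogeneous_d (p + 1)) hx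
      fun τ => (F.exact_d p _).1 (congrFun h τ))
    (fun q x hx h => exists_comp_eq_of_forall_mem_range _ (F.homogeneous_d 0) hx
      fun τ => (F.exact_aug _).1 (congrFun h τ))
    (fun q x hx => by
      obtain ⟨g, hg, hg'⟩ := exists_comp_eq_of_forall_mem_range ε hε (hsingle q x hx) (by
        intro τ
        have : x τ ∈ LinearMap.range F.aug := by
          rw [F.range_aug]
          exact (hx τ).2.2
        obtain ⟨y, hy⟩ := this
        exact ⟨y, by simp [ε, hy]⟩)
      refine ⟨g, hg, ?_⟩
      funext τ
      have h2 := DFunLike.congr_fun (congrFun hg' τ) ()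
      simpa [ε] using h2)
    (fun q p x hx h => exists_koszul_eq_of_free he hx (fun h' => absurd h' (Nat.succ_ne_zero q)) h)
    p (fun x hx h => by
      have hx' : ∀ τ m, (x τ).coeff m ≠ 0 → τ.card = p ∧ (m.degree : ℤ) = j - p ∧
          MvPolynomial.monomial m (1 : K) ∈ I := by
        intro τ m hm
        refine ⟨?_, ?_, hI.monomial_mem (hx τ).2.2 hm⟩
        · by_contra h
          rw [(hx τ).1 h] at hm
          exact hm rfl
        · by_contra h
          exact hm ((hx τ).2.1 m h)
      -- The degree condition in `U` forces the multidegree `a` to have total degree `j`, where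
      -- `hcone` is available.
      obtain ⟨g, hg, hg'⟩ := exists_koszul_eq he (q := p)
        (U := fun m => (m.degree : ℤ) = j - p ∧ MvPolynomial.monomial m (1 : K) ∈ I)
        (V := fun m => MvPolynomial.monomial m (1 : K) ∈ I) (by
          rintro a m ρ hρ rfl ⟨hm, -⟩
          obtain ⟨v, hv, hv'⟩ := hcone (m + indic ρ) (by
            rw [map_add, degree_indic, hρ]; push_cast; omega)
          exact ⟨v, hv, fun ρ' b h1 h2 h3 h4 => hv' ρ' b h1 h2 h3 h4.2⟩) x hx' h
      refine ⟨g, fun τ => ⟨fun h => ?_, fun m h => ?_, ?_⟩, hg⟩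
      · ext m
        by_contra hne
        exact h (hg' τ m hne).1
      · by_contra hne
        obtain ⟨hτ, -, ρ, m', h', h''⟩ := hg' τ m hne
        obtain ⟨hρ, hd, -⟩ := hx' _ _ h'
        apply h
        have h1 := congrArg Finsupp.degree h''
        rw [map_add, map_add, degree_indic, degree_indic] at h1
        push_cast
        omega
      · exact mem_of_forall_monomial_mem fun m hm => (hg' τ m hm).2.1)
  -- lift a cycle of `K ⊗ F` to a Koszul chain
  intro z hz
  have hzdeg : z ∈ F.degreePart p j := by
    cases p with
    | zero => exact hz
    | succ p => exact hz.1
  rw [degreePart, Finsupp.mem_supported'] at hzdeg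
  let x : F.B p →₀ MvPolynomial σ K := z.mapRange MvPolynomial.C (map_zero _)
  let f : Finset σ → (F.B p →₀ MvPolynomial σ K) := fun τ => if τ = ∅ then x else 0
  have hx : reduceConst x = z := by
    ext b; simp [reduceConst, x]
  have hf : f ∈ koszulPart K σ (F.deg p) j 0 := by
    intro τ
    refine ⟨fun h => if_neg fun h' => h (by rw [h', Finset.card_empty]), fun b m h => ?_⟩
    simp only [f]
    split_ifs with hτ
    · simp only [x, Finsupp.mapRange_apply, MvPolynomial.coeff_C]
      split_ifs with hm
      · subst hm
        refine hzdeg b fun h' => h ?_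
        simpa using h'
      · rfl
    · rfl
  have hkos0 : ∀ {M : Type _} [AddCommGroup M] [Module (MvPolynomial σ K) M] (y : M),
      koszul K e (fun τ : Finset σ => if τ = ∅ then y else 0) = 0 := by
    intro M _ _ y
    funext τ
    rw [koszul_apply]
    exact Finset.sum_eq_zero fun v _ => by
      rw [if_neg (Finset.insert_ne_empty _ _), smul_zero, smul_zero]
  -- The constant lift of `z`, placed at the empty face, is a boundary of the double complex.
  -- Reducing this identity modulo the variables exhibits `z` as a boundary of `K ⊗ F`.
  have hfin : ∃ y ∈ koszulPart K σ (F.deg (p + 1)) j 0, ∃ y' ∈ koszulPart K σ (F.deg p) j 1,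
      f = F.d p ∘ y + koszul K e y' := by
    cases p with
    | zero =>
      refine h0 f hf ?_
      have : (F.aug ∘ f) = fun τ : Finset σ => if τ = ∅ then F.aug x else 0 := by
        funext τ
        simp only [f, Function.comp_apply]
        split_ifs
        · rfl
        · rw [map_zero]
      exact (congrArg (koszul K e) this).trans (hkos0 _)
    | succ p =>
      have hdf : (F.d p ∘ f) = fun τ : Finset σ => if τ = ∅ then F.d p x else 0 := by
        funext τ
        simp only [f, Function.comp_apply]
        split_ifs
        · rfl
        · rw [map_zero]
      -- Since `z` is a cycle of `K ⊗ F`, the entries of `F.d p x` have no constant terms, which is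
      -- the condition for being a Koszul boundary in degree `0`.
      obtain ⟨g, hg, hg'⟩ := exists_koszul_eq_of_free he
        (comp_mem_koszulPart (F.d p) (F.homogeneous_d p) hf) (fun _ b => by
          rw [hdf]
          have h2 : reduceConst (F.d p x) = 0 := by
            rw [← dBar_reduceConst, hx]; exact hz.2
          exact DFunLike.congr_fun h2 b) (by rw [hdf]; exact hkos0 _)
      exact h1 p 0 (by omega) f hf g hg hg'.symm
  obtain ⟨y, hy, y', hy', hfy⟩ := hfin
  refine ⟨reduceConst (y ∅), ?_, ?_⟩
  · change _ ∈ F.degreePart (p + 1) j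
    rw [degreePart, Finsupp.mem_supported']
    intro b hb
    refine (hy ∅).2 b 0 ?_
    simpa using hb
  · rw [dBar_reduceConst]
    ext b
    have h2 := congrFun hfy ∅
    have h3 : F.d p (y ∅) = x - koszul K e y' ∅ := by
      rw [eq_sub_iff_add_eq]
      exact h2.symm
    rw [h3]
    -- Every term of a Koszul boundary is a multiple of a variable.
    have h4 : ((koszul K e y' ∅) b).coeff 0 = 0 := by
      rw [koszul_apply, Finsupp.finsetSum_apply, MvPolynomial.coeff_sum]
      refine Finset.sum_eq_zero fun v _ => ?_
      rw [Finsupp.smul_apply, MvPolynomial.coeff_smul, Finsupp.smul_apply, smul_eq_mul, mul_comm,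
        MvPolynomial.coeff_mul_X']
      simp
    have h5 := DFunLike.congr_fun hx b
    simp only [reduceConst, Finsupp.mapRange_apply, Finsupp.sub_apply, map_sub] at h5 ⊢
    rw [h5, MvPolynomial.constantCoeff_eq, h4, sub_zero]

end GradedFreeResolution

end TorVanishing

/-! ### Embeddings of monomials -/

section Embedding

variable {K : Type*} [Field K] {c : ℕ}

theorem monomial_mem_of_le {σ : Type*} {J : Ideal (MvPolynomial σ K)} {u b : σ →₀ ℕ}
    (hu : MvPolynomial.monomial u (1 : K) ∈ J) (h : u ≤ b) :
    MvPolynomial.monomial b (1 : K) ∈ J := by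
  have : MvPolynomial.monomial b (1 : K) =
      MvPolynomial.monomial (b - u) 1 * MvPolynomial.monomial u 1 := by
    rw [MvPolynomial.monomial_mul, tsub_add_cancel_of_le h, one_mul]
  rw [this]
  exact J.mul_mem_left _ hu

theorem monomial_mem_of_embedding {i : ℕ} {I : ∀ n, Ideal (R K c n)} (hinv : IsInvariantChain i I)
    {m n : ℕ} (him : i < m) {u : Fin c × Fin m →₀ ℕ} {b : Fin c × Fin n →₀ ℕ}
    (hu : MvPolynomial.monomial u (1 : K) ∈ I m) {φ : Fin m → Fin n} (hφ : StrictMono φ)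
    (hfix : ∀ j : Fin m, (j : ℕ) < i → (φ j : ℕ) = j) (hle : ∀ k j, u (k, j) ≤ b (k, φ j)) :
    MvPolynomial.monomial b (1 : K) ∈ I n := by
  have hmn : m ≤ n := by simpa using Fintype.card_le_of_injective φ hφ.injective
  -- Beyond the `m` columns, `j + n` exceeds all values of `φ`, so `π` stays strictly increasing; `i
  -- < m` puts all fixed columns in the domain of `φ`.
  let π : ℕ → ℕ := fun j => if h : j < m then φ ⟨j, h⟩ else j + n
  have hπ : ∀ j (h : j < m), π j = φ ⟨j, h⟩ := fun j h => dif_pos h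
  have hmem : π ∈ Inc i := by
    refine ⟨fun a b hab => ?_, fun j hj => ?_⟩
    · by_cases hb : b < m
      · rw [hπ a (hab.trans hb), hπ b hb]
        exact hφ hab
      · by_cases ha : a < m
        · rw [hπ a ha]
          have := (φ ⟨a, ha⟩).isLt
          simp only [π, dif_neg hb]
          omega
        · simp only [π, dif_neg hb, dif_neg ha]
          omega
    · rw [hπ j (hj.trans him)]
      exact hfix _ hj
  have hlt : ∀ j < m, π j < n := fun j hj => by
    rw [hπ j hj]
    exact (φ _).isLt
  have h := hinv m n (by omega) hmn π hmem hlt _ hu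
  rw [act, MvPolynomial.rename_monomial] at h
  refine monomial_mem_of_le h ?_
  have hinj : Function.Injective
      (fun v : Fin c × Fin m => ((v.1, ⟨π v.2, hlt v.2 v.2.isLt⟩) : Fin c × Fin n)) := by
    rintro ⟨k, j⟩ ⟨k', j'⟩ h
    simp only [Prod.mk.injEq, Fin.mk.injEq] at h
    exact Prod.ext h.1 (Fin.ext (hmem.1.injective h.2))
  intro v
  by_cases hv : v ∈ Set.range
      (fun v : Fin c × Fin m => ((v.1, ⟨π v.2, hlt v.2 v.2.isLt⟩) : Fin c × Fin n))
  · obtain ⟨⟨k, j⟩, rfl⟩ := hv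
    rw [Finsupp.mapDomain_apply hinj]
    have : (⟨π j, hlt j j.isLt⟩ : Fin n) = φ j := Fin.ext (hπ j j.isLt)
    simp only [this]
    exact hle k j
  · rw [Finsupp.mapDomain_of_notMem_range _ _ hv]
    exact Nat.zero_le _

/-- The word of the columns of a monomial; each column is tagged so that an embedding of words
fixes the first `i` columns. -/
def columnWord (i : ℕ) {n : ℕ} (u : Fin c × Fin n →₀ ℕ) : List ((Fin c → ℕ) × ℕ × ℕ) :=
  List.ofFn fun j : Fin n => (fun k => u (k, j), min (j : ℕ) i, i - min (j : ℕ) i)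

theorem exists_embedding_of_sublistForall₂ {i m n : ℕ} {g : Fin c × Fin m →₀ ℕ}
    {u : Fin c × Fin n →₀ ℕ}
    (h : List.SublistForall₂ (· ≤ ·) (columnWord i g) (columnWord i u)) :
    ∃ φ : Fin m → Fin n, StrictMono φ ∧ (∀ j : Fin m, (j : ℕ) < i → (φ j : ℕ) = j) ∧
      ∀ k j, g (k, j) ≤ u (k, φ j) := by
  obtain ⟨l, hl, hsub⟩ := List.sublistForall₂_iff.1 h
  obtain ⟨f, hf⟩ := List.sublist_iff_exists_fin_orderEmbedding_get_eq.1 hsub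
  have hlen : (columnWord i g).length = m := by simp [columnWord]
  have hlen' : (columnWord i u).length = n := by simp [columnWord]
  have hll : m = l.length := hlen.symm.trans hl.length_eq
  have key : ∀ j : Fin m, (columnWord i g).get (Fin.cast hlen.symm j) ≤
      (columnWord i u).get (f (Fin.cast hll j)) := by
    intro j
    rw [← hf]
    exact hl.get _ _
  let φ : Fin m → Fin n := fun j => Fin.cast hlen' (f (Fin.cast hll j))
  -- The tags `min j i` and `i - min j i` vary in opposite directions, so comparing both forces
  -- equality of `min j i` and hence `φ j = j` for `j < i`.
  have key' : ∀ j : Fin m, (∀ k, g (k, j) ≤ u (k, φ j)) ∧ min (j : ℕ) i ≤ min (φ j : ℕ) i ∧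
      i - min (j : ℕ) i ≤ i - min (φ j : ℕ) i := by
    intro j
    have := key j
    simp only [columnWord, List.get_eq_getElem, List.getElem_ofFn] at this
    exact ⟨this.1, this.2.1, this.2.2⟩
  refine ⟨φ, fun a b hab => ?_, fun j hj => ?_, fun k j => (key' j).1 k⟩
  · exact f.strictMono (show Fin.cast hll a < Fin.cast hll b from hab)
  · have := (key' j).2
    omega

/-- Monomials in infinitely many columns are noetherian up to symmetry: all monomials of a chain
dominate one of a bounded set of monomials of the chain. -/
theorem exists_bounded_embedding (i : ℕ) (U : ∀ n, (Fin c × Fin n →₀ ℕ) → Prop) :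
    ∃ r B : ℕ, ∀ n, i < n → ∀ u, U n u → ∃ m, i < m ∧ m ≤ r ∧ ∃ g, U m g ∧
      (∀ v, g v ≤ B) ∧ ∃ φ : Fin m → Fin n, StrictMono φ ∧
        (∀ j : Fin m, (j : ℕ) < i → (φ j : ℕ) = j) ∧ ∀ k j, g (k, j) ≤ u (k, φ j) := by
  by_contra! hcon
  -- If no bounds work, each finite set of monomials can be extended: taking `r` and `B` as its
  -- maximal column number and exponent yields a monomial dominating none of its members. The
  -- resulting bad sequence contradicts Higman's lemma for words over a well-quasi-ordered alphabet.
  obtain ⟨f, hf, hf'⟩ := exists_seq_of_forall_finset_exists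
    (α := Σ n, (Fin c × Fin n →₀ ℕ)) (fun w => i < w.1 ∧ U w.1 w.2)
    (fun x y => ¬ List.SublistForall₂ (· ≤ ·) (columnWord i x.2) (columnWord i y.2)) (by
      intro s hs
      obtain ⟨n, hn, u, hu, hbad⟩ := hcon (s.sup fun w => w.1)
        (s.sup fun w => Finset.univ.sup fun v => w.2 v)
      refine ⟨⟨n, u⟩, ⟨hn, hu⟩, fun x hx hsub => ?_⟩
      obtain ⟨φ, h1, h2, h3⟩ := exists_embedding_of_sublistForall₂ hsub
      obtain ⟨k, j, h4⟩ := hbad x.1 (hs x hx).1 (Finset.le_sup (f := fun w => w.1) hx) x.2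
        (hs x hx).2 (fun v => le_trans (Finset.le_sup (f := fun v => x.2 v) (Finset.mem_univ v))
          (Finset.le_sup (f := fun w : Σ n, (Fin c × Fin n →₀ ℕ) =>
            Finset.univ.sup fun v => w.2 v) hx)) φ h1 h2
      exact absurd (h3 k j) (not_le.2 h4))
  have hpwo := Set.PartiallyWellOrderedOn.partiallyWellOrderedOn_sublistForall₂
    (α := (Fin c → ℕ) × ℕ × ℕ) (· ≤ ·) (s := Set.univ)
    (Set.partiallyWellOrderedOn_univ_iff.2 wellQuasiOrdered_le)
  obtain ⟨a, b, hab, h⟩ := hpwo.exists_lt (f := fun t => columnWord i (f t).2)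
    (fun _ _ _ => Set.mem_univ _)
  exact hf' a b hab h

end Embedding

/-! ### Eventually constant sequences -/

theorem exists_eventually_eq_of_antitone {f : ℕ → ℕ} (h : ∀ᶠ n in atTop, f (n + 1) ≤ f n) :
    ∃ a, ∀ᶠ n in atTop, f n = a := by
  obtain ⟨N, hN⟩ := eventually_atTop.1 h
  have hne : (f '' Set.Ici N).Nonempty := ⟨f N, N, le_refl N, rfl⟩
  obtain ⟨n₁, hn₁, he⟩ := Nat.sInf_mem hne
  refine ⟨f n₁, eventually_atTop.2 ⟨n₁, fun n hn => le_antisymm ?_ ?_⟩⟩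
  · induction n, hn using Nat.le_induction with
    | base => exact le_rfl
    | succ n hn ih => exact (hN n (le_trans hn₁ hn)).trans ih
  · rw [he]
    exact Nat.sInf_le ⟨n, le_trans hn₁ hn, rfl⟩

theorem exists_eventually_eq_of_monotone {f : ℕ → ℕ} {B : ℕ} (hB : ∀ᶠ n in atTop, f n ≤ B)
    (h : ∀ᶠ n in atTop, f n ≤ f (n + 1)) : ∃ a, ∀ᶠ n in atTop, f n = a := by
  obtain ⟨a, ha⟩ := exists_eventually_eq_of_antitone (f := fun n => B - f n)
    (h.mono fun n hn => Nat.sub_le_sub_left hn B)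
  refine ⟨B - a, (ha.and hB).mono fun n hn => ?_⟩
  have := hn.1
  have := hn.2
  omega

theorem exists_eventually_eq_of_subset {A : ℕ → Set ℕ} {B : ℕ}
    (hB : ∀ᶠ n in atTop, A n ⊆ Set.Iic B) (h : ∀ᶠ n in atTop, A (n + 1) ⊆ A n) :
    ∃ S, ∀ᶠ n in atTop, A n = S := by
  have hfin : ∀ᶠ n in atTop, (A n).Finite := hB.mono fun n hn => (Set.finite_Iic B).subset hn
  obtain ⟨a, ha⟩ := exists_eventually_eq_of_antitone (f := fun n => (A n).ncard)
    ((h.and hfin).mono fun n hn => Set.ncard_le_ncard hn.1 hn.2)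
  obtain ⟨N, hN⟩ := eventually_atTop.1 ((h.and hfin).and ha)
  refine ⟨A N, eventually_atTop.2 ⟨N, fun n hn => ?_⟩⟩
  induction n, hn using Nat.le_induction with
  | base => rfl
  | succ n hn ih =>
    rw [← ih]
    refine Set.eq_of_subset_of_ncard_le (hN n hn).1.1 ?_ (hN n hn).1.2
    rw [(hN n hn).2, (hN (n + 1) (by omega)).2]

theorem exists_iterated_eventually_eq_of_antitone {f : ℕ → ℕ → ℕ}
    (hf : ∀ s, ∃ a, ∀ᶠ n in atTop, f s n = a)
    (h : ∀ᶠ s in atTop, ∀ᶠ n in atTop, f (s + 1) n ≤ f s n) :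
    ∃ a, ∀ᶠ s in atTop, ∀ᶠ n in atTop, f s n = a := by
  choose V hV using hf
  obtain ⟨a, ha⟩ := exists_eventually_eq_of_antitone (f := V) (h.mono fun s hs => by
    obtain ⟨n, ⟨h1, h2⟩, h3⟩ := ((hs.and (hV s)).and (hV (s + 1))).exists
    rwa [h2, h3] at h1)
  exact ⟨a, ha.mono fun s hs => (hV s).mono fun n hn => hn.trans hs⟩

theorem exists_iterated_eventually_eq_of_monotone {f : ℕ → ℕ → ℕ} {B : ℕ}
    (hf : ∀ s, ∃ a, ∀ᶠ n in atTop, f s n = a) (hB : ∀ s, ∀ᶠ n in atTop, f s n ≤ B)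
    (h : ∀ s, ∀ᶠ n in atTop, f s n ≤ f (s + 1) n) :
    ∃ a, ∀ᶠ s in atTop, ∀ᶠ n in atTop, f s n = a := by
  choose V hV using hf
  obtain ⟨a, ha⟩ := exists_eventually_eq_of_monotone (f := V) (B := B)
    (Eventually.of_forall fun s => by
      obtain ⟨n, h1, h2⟩ := ((hB s).and (hV s)).exists
      rwa [h2] at h1)
    (Eventually.of_forall fun s => by
      obtain ⟨n, ⟨h1, h2⟩, h3⟩ := (((h s).and (hV s)).and (hV (s + 1))).exists
      rwa [h2, h3] at h1)
  exact ⟨a, ha.mono fun s hs => (hV s).mono fun n hn => hn.trans hs⟩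

theorem eventualValue_eq {f : ℕ → ℕ} {a : ℕ} (h : ∀ᶠ n in atTop, f n = a) :
    eventualValue f = a := by
  have hex : ∃ a, ∀ᶠ n in atTop, f n = a := ⟨a, h⟩
  rw [eventualValue, dif_pos hex]
  obtain ⟨n, h1, h2⟩ := (hex.choose_spec.and h).exists
  exact h1.symm.trans h2

theorem iterated_eventually_eq_eventualValue {f : ℕ → ℕ → ℕ}
    (h : ∃ a, ∀ᶠ s in atTop, ∀ᶠ n in atTop, f s n = a) :
    ∀ᶠ s in atTop, ∀ᶠ n in atTop, f s n = eventualValue fun s => eventualValue (f s) := by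
  obtain ⟨a, ha⟩ := h
  rwa [eventualValue_eq (ha.mono fun s hs => eventualValue_eq hs)]

/-! ### Weights of minimal generators -/

section Weights

variable {K : Type*} [Field K] {c : ℕ}

/-- `minIndex` counts columns from `1` and `Fin n` from `0`, whence `s ≤ j`; the condition `u ≠ 0`
reflects `minIndex 0 = 0`. -/
theorem lt_minIndex_iff {n s : ℕ} {u : Fin c × Fin n →₀ ℕ} :
    s < minIndex u ↔ u ≠ 0 ∧ ∀ k j, u (k, j) ≠ 0 → s ≤ (j : ℕ) := by
  constructor
  · intro h
    have hne : {j | ∃ v ∈ u.support, j = (v.2 : ℕ) + 1}.Nonempty :=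
      Nat.nonempty_of_pos_sInf (lt_of_le_of_lt (Nat.zero_le s) h)
    obtain ⟨-, v, hv, -⟩ := hne
    refine ⟨fun h0 => by simp [h0] at hv, fun k j hkj => ?_⟩
    have : minIndex u ≤ (j : ℕ) + 1 := Nat.sInf_le ⟨(k, j), Finsupp.mem_support_iff.2 hkj, rfl⟩
    omega
  · rintro ⟨hu, h⟩
    obtain ⟨v, hv⟩ := Finsupp.support_nonempty_iff.2 hu
    obtain ⟨⟨k, j⟩, hw, he⟩ := Nat.sInf_mem
      (s := {j | ∃ v ∈ u.support, j = (v.2 : ℕ) + 1}) ⟨_, v, hv, rfl⟩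
    have := h k j (Finsupp.mem_support_iff.1 hw)
    rw [minIndex, he]
    exact Nat.lt_succ_of_le this

theorem monWeightRow_le_iff {n s : ℕ} {k : Fin c} {u : Fin c × Fin n →₀ ℕ} {a : ℕ} :
    monWeightRow s k u ≤ a ↔ ∀ j : Fin n, s ≤ (j : ℕ) → u (k, j) ≤ a := by
  simp [monWeightRow, Finset.sup_le_iff]

theorem monWeight_le_iff {n s : ℕ} {u : Fin c × Fin n →₀ ℕ} {a : ℕ} :
    monWeight s u ≤ a ↔ ∀ k, ∀ j : Fin n, s ≤ (j : ℕ) → u (k, j) ≤ a := by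
  simp [monWeight, Finset.sup_le_iff, monWeightRow_le_iff]

theorem le_monWeightRow {n s : ℕ} (k : Fin c) (u : Fin c × Fin n →₀ ℕ) {j : Fin n}
    (hj : s ≤ (j : ℕ)) : u (k, j) ≤ monWeightRow s k u :=
  monWeightRow_le_iff.1 le_rfl j hj

theorem le_monWeight {n s : ℕ} (k : Fin c) (u : Fin c × Fin n →₀ ℕ) {j : Fin n}
    (hj : s ≤ (j : ℕ)) : u (k, j) ≤ monWeight s u :=
  monWeight_le_iff.1 le_rfl k j hj

theorem exists_mem_minGens_le {σ : Type*} [Finite σ] {J : Ideal (MvPolynomial σ K)} {b : σ →₀ ℕ}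
    (hb : MvPolynomial.monomial b (1 : K) ∈ J) : ∃ u ∈ minGens J, u ≤ b := by
  obtain ⟨u, hu, hu'⟩ := exists_minimal_le_of_wellFoundedLT
    (fun v => MvPolynomial.monomial v (1 : K) ∈ J) b hb
  exact ⟨u, hu', hu⟩

/-- The monomial obtained from `u` by deleting the column `q`. -/
def deleteColumn {n : ℕ} (q : Fin (n + 1)) (u : Fin c × Fin (n + 1) →₀ ℕ) :
    Fin c × Fin n →₀ ℕ :=
  Finsupp.equivFunOnFinite.symm fun v => u (v.1, q.succAbove v.2)

theorem deleteColumn_apply {n : ℕ} (q : Fin (n + 1)) (u : Fin c × Fin (n + 1) →₀ ℕ) (k : Fin c)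
    (j : Fin n) : deleteColumn q u (k, j) = u (k, q.succAbove j) := rfl

theorem le_succAbove_iff {n s : ℕ} {q : Fin (n + 1)} (hq : s ≤ (q : ℕ)) (j : Fin n) :
    s ≤ (q.succAbove j : ℕ) ↔ s ≤ (j : ℕ) := by
  rcases lt_or_ge j.castSucc q with h | h
  · rw [Fin.succAbove_of_castSucc_lt _ _ h, Fin.val_castSucc]
  · rw [Fin.succAbove_of_le_castSucc _ _ h, Fin.val_succ]
    have : (q : ℕ) ≤ j := h
    omega

theorem succAbove_val_of_lt {n s : ℕ} {q : Fin (n + 1)} (hq : s ≤ (q : ℕ)) {j : Fin n}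
    (hj : (j : ℕ) < s) : (q.succAbove j : ℕ) = j := by
  rw [Fin.succAbove_of_castSucc_lt _ _ (show (j : ℕ) < q by omega), Fin.val_castSucc]

theorem monWeightRow_deleteColumn {n s : ℕ} {q : Fin (n + 1)} (hq : s ≤ (q : ℕ))
    {u : Fin c × Fin (n + 1) →₀ ℕ} (hu : ∀ k, u (k, q) = 0) (k : Fin c) :
    monWeightRow s k (deleteColumn q u) = monWeightRow s k u := by
  apply le_antisymm
  · rw [monWeightRow_le_iff]
    intro j hj
    exact le_monWeightRow k u ((le_succAbove_iff hq j).2 hj)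
  · rw [monWeightRow_le_iff]
    intro j hj
    rcases eq_or_ne j q with rfl | hjq
    · rw [hu]
      exact Nat.zero_le _
    · obtain ⟨j, rfl⟩ := Fin.exists_succAbove_eq hjq
      exact le_monWeightRow k (deleteColumn q u) ((le_succAbove_iff hq j).1 hj)

theorem lt_minIndex_deleteColumn {n s : ℕ} {q : Fin (n + 1)} (hq : s ≤ (q : ℕ))
    {u : Fin c × Fin (n + 1) →₀ ℕ} (hu : ∀ k, u (k, q) = 0) (h : s < minIndex u) :
    s < minIndex (deleteColumn q u) := by
  rw [lt_minIndex_iff] at h ⊢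
  refine ⟨fun h0 => h.1 ?_, fun k j hkj => (le_succAbove_iff hq j).1 (h.2 _ _ hkj)⟩
  ext ⟨k, j⟩
  rcases eq_or_ne j q with rfl | hjq
  · exact hu k
  · obtain ⟨j, rfl⟩ := Fin.exists_succAbove_eq hjq
    exact DFunLike.congr_fun h0 (k, j)

/-- Every monomial of the chain in more than `i` columns is divisible by the image, under the action
of `Inc(ℕ)^i`, of a monomial of the chain in at most `r` columns with exponents at most `B`. -/
def IsGeneratedUpTo (i r B : ℕ) (I : ∀ n, Ideal (R K c n)) : Prop :=
  ∀ n, i < n → ∀ u, MvPolynomial.monomial u (1 : K) ∈ I n → ∃ m, i < m ∧ m ≤ r ∧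
    ∃ g, MvPolynomial.monomial g (1 : K) ∈ I m ∧ (∀ v, g v ≤ B) ∧
      ∃ φ : Fin m → Fin n, StrictMono φ ∧ (∀ j : Fin m, (j : ℕ) < i → (φ j : ℕ) = j) ∧
        ∀ k j, g (k, j) ≤ u (k, φ j)

variable {i r B : ℕ} {I : ∀ n, Ideal (R K c n)}

/-- The shifted copy of `g` lies in `I n` and divides `u`, so it equals `u` by minimality. Hence `u`
inherits the bound `B` and occupies at most `r` columns. -/
theorem exists_eq_embedding_of_mem_minGens (hinv : IsInvariantChain i I)
    (hgen : IsGeneratedUpTo i r B I) {n : ℕ} (hn : i < n) {u : Fin c × Fin n →₀ ℕ}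
    (hu : u ∈ minGens (I n)) : (∀ v, u v ≤ B) ∧ ∃ m, i < m ∧ m ≤ r ∧
      ∃ g, MvPolynomial.monomial g (1 : K) ∈ I m ∧ ∃ φ : Fin m → Fin n, StrictMono φ ∧
        (∀ j : Fin m, (j : ℕ) < i → (φ j : ℕ) = j) ∧ (∀ k j, g (k, j) ≤ u (k, φ j)) ∧
          ∀ k j, j ∉ Set.range φ → u (k, j) = 0 := by
  obtain ⟨m, him, hmr, g, hg, hgB, φ, hφ, hfix, hle⟩ := hgen n hn u hu.1
  have hinj : Function.Injective (Prod.map id φ : Fin c × Fin m → Fin c × Fin n) :=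
    Function.injective_id.prodMap hφ.injective
  have happ : ∀ k j, g.mapDomain (Prod.map id φ) (k, φ j) = g (k, j) := fun k j =>
    Finsupp.mapDomain_apply hinj g (k, j)
  have hzero : ∀ k j, j ∉ Set.range φ → g.mapDomain (Prod.map id φ) (k, j) = 0 := by
    intro k j hj
    refine Finsupp.mapDomain_of_notMem_range _ _ ?_
    rintro ⟨⟨k', j'⟩, h⟩
    exact hj ⟨j', (Prod.ext_iff.1 h).2⟩
  have hmem : MvPolynomial.monomial (g.mapDomain (Prod.map id φ)) (1 : K) ∈ I n :=
    monomial_mem_of_embedding hinv him hg hφ hfix fun k j => (happ k j).ge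
  have hge : u ≤ g.mapDomain (Prod.map id φ) := by
    refine hu.2 hmem ?_
    rintro ⟨k, j⟩
    by_cases hj : j ∈ Set.range φ
    · obtain ⟨j, rfl⟩ := hj
      rw [happ]
      exact hle k j
    · rw [hzero k j hj]
      exact Nat.zero_le _
  refine ⟨?_, m, him, hmr, g, hg, φ, hφ, hfix, hle, fun k j hj =>
    Nat.le_zero.1 ((hge (k, j)).trans (hzero k j hj).le)⟩
  rintro ⟨k, j⟩
  by_cases hj : j ∈ Set.range φ
  · obtain ⟨j, rfl⟩ := hj
    exact (hge _).trans ((happ k j).le.trans (hgB _))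
  · exact (hge _).trans ((hzero k j hj).le.trans (Nat.zero_le _))

/-- An empty column past the first `i` can be deleted because the embedding of `g` avoids it.
Minimality survives because reinserting an empty column is itself a shift in `Inc i`. -/
theorem exists_deleteColumn_mem_minGens (hinv : IsInvariantChain i I)
    (hgen : IsGeneratedUpTo i r B I) {s n : ℕ} (his : i ≤ s) (hn : r + s < n)
    {u : Fin c × Fin (n + 1) →₀ ℕ} (hu : u ∈ minGens (I (n + 1))) :
    ∃ q : Fin (n + 1), s ≤ (q : ℕ) ∧ (∀ k, u (k, q) = 0) ∧ deleteColumn q u ∈ minGens (I n) := by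
  classical
  obtain ⟨-, m, him, hmr, g, hg, φ, hφ, hfix, hle, hzero⟩ :=
    exists_eq_embedding_of_mem_minGens hinv hgen (by omega) hu
  -- Pigeonhole: of the `r + 1` columns `s, …, s + r`, the at most `r` columns in the image of `φ`
  -- miss one.
  obtain ⟨q, hq, hqφ⟩ : ∃ q ∈ (Finset.univ : Finset (Fin (r + 1))).image
      (fun t : Fin (r + 1) => (⟨s + t, by omega⟩ : Fin (n + 1))), q ∉ (Finset.univ : Finset (Fin m)).image φ := by
    apply Finset.exists_mem_notMem_of_card_lt_card
    rw [Finset.card_image_of_injective (f := fun t : Fin (r + 1) =>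
      (⟨s + t, by omega⟩ : Fin (n + 1)))]
    · refine lt_of_le_of_lt Finset.card_image_le ?_
      simp only [Finset.card_univ, Fintype.card_fin]
      omega
    · intro a b hab
      simp only [Fin.mk.injEq] at hab
      exact Fin.ext (by omega)
  have hsq : s ≤ (q : ℕ) := by
    obtain ⟨t, -, rfl⟩ := Finset.mem_image.1 hq
    exact Nat.le_add_right _ _
  have hqr : q ∉ Set.range φ := by simpa using hqφ
  have hfix' : ∀ j : Fin n, (j : ℕ) < i → (q.succAbove j : ℕ) = j :=
    fun j hj => succAbove_val_of_lt (his.trans hsq) hj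
  refine ⟨q, hsq, fun k => hzero k q hqr, ?_, ?_⟩
  · have hψ : ∀ j, ∃ j', q.succAbove j' = φ j := fun j =>
      Fin.exists_succAbove_eq fun h => hqr ⟨j, h⟩
    choose ψ hψ using hψ
    refine monomial_mem_of_embedding hinv him hg (φ := ψ) (fun a b hab => ?_) (fun j hj => ?_) ?_
    · rw [← (Fin.strictMono_succAbove q).lt_iff_lt, hψ, hψ]
      exact hφ hab
    · have h1 := hfix j hj
      rw [← hψ] at h1
      have h2 := le_succAbove_iff (his.trans hsq) (ψ j)
      rw [← hfix' (ψ j) (by omega), h1]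
    · intro k j
      rw [deleteColumn_apply, hψ]
      exact hle k j
  · intro x hx hxu
    let X : Fin c × Fin (n + 1) →₀ ℕ := x.mapDomain (Prod.map id q.succAbove)
    have happ : ∀ k j, X (k, q.succAbove j) = x (k, j) := fun k j =>
      Finsupp.mapDomain_apply
        (Function.injective_id.prodMap (Fin.strictMono_succAbove q).injective) x (k, j)
    have hX : MvPolynomial.monomial X (1 : K) ∈ I (n + 1) :=
      monomial_mem_of_embedding hinv (by omega) hx (Fin.strictMono_succAbove q) hfix'
        fun k j => (happ k j).ge
    have hle' : X ≤ u := by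
      rintro ⟨k, j⟩
      rcases eq_or_ne j q with rfl | hjq
      · have : X (k, j) = 0 := by
          refine Finsupp.mapDomain_of_notMem_range _ _ ?_
          rintro ⟨⟨k', j'⟩, h⟩
          exact Fin.succAbove_ne j j' (Prod.ext_iff.1 h).2
        rw [this]
        exact Nat.zero_le _
      · obtain ⟨j, rfl⟩ := Fin.exists_succAbove_eq hjq
        rw [happ]
        exact hxu (k, j)
    rintro ⟨k, j⟩
    rw [← happ]
    exact hu.2 hX hle' (k, q.succAbove j)

theorem exists_mem_minGens_of_succ (hinv : IsInvariantChain i I)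
    (hgen : IsGeneratedUpTo i r B I) {s n : ℕ} (hn : r + (i + s) < n)
    {u : Fin c × Fin (n + 1) →₀ ℕ} (hu : u ∈ minGens (I (n + 1))) :
    ∃ u' ∈ minGens (I n), (∀ k, monWeightRow s k u' = monWeightRow s k u) ∧
      monWeight s u' = monWeight s u ∧ (s < minIndex u → s < minIndex u') := by
  obtain ⟨q, hq, hq0, hmem⟩ := exists_deleteColumn_mem_minGens hinv hgen
    (Nat.le_add_right i s) hn hu
  have hsq : s ≤ (q : ℕ) := le_trans (Nat.le_add_left _ _) hq
  refine ⟨_, hmem, monWeightRow_deleteColumn hsq hq0, ?_, lt_minIndex_deleteColumn hsq hq0⟩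
  simp only [monWeight, monWeightRow_deleteColumn hsq hq0]

theorem monWeightRow_le_of_mem_minGens (hinv : IsInvariantChain i I)
    (hgen : IsGeneratedUpTo i r B I) {n : ℕ} (hn : i < n) {u : Fin c × Fin n →₀ ℕ}
    (hu : u ∈ minGens (I n)) (s : ℕ) (k : Fin c) : monWeightRow s k u ≤ B :=
  monWeightRow_le_iff.2 fun j _ => (exists_eq_embedding_of_mem_minGens hinv hgen hn hu).1 (k, j)

theorem monWeight_le_of_mem_minGens (hinv : IsInvariantChain i I)
    (hgen : IsGeneratedUpTo i r B I) {n : ℕ} (hn : i < n) {u : Fin c × Fin n →₀ ℕ}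
    (hu : u ∈ minGens (I n)) (s : ℕ) : monWeight s u ≤ B :=
  monWeight_le_iff.2 fun k j _ => (exists_eq_embedding_of_mem_minGens hinv hgen hn hu).1 (k, j)

theorem monWeightRow_le_weightRow (hinv : IsInvariantChain i I)
    (hgen : IsGeneratedUpTo i r B I) {n : ℕ} (hn : i < n) {u : Fin c × Fin n →₀ ℕ}
    (hu : u ∈ minGens (I n)) (s : ℕ) (k : Fin c) : monWeightRow s k u ≤ weightRow s k (I n) :=
  le_csSup ⟨B, by
    rintro _ ⟨v, hv, rfl⟩
    exact monWeightRow_le_of_mem_minGens hinv hgen hn hv s k⟩ ⟨u, hu, rfl⟩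

theorem monWeight_le_sSup (hinv : IsInvariantChain i I)
    (hgen : IsGeneratedUpTo i r B I) {n : ℕ} (hn : i < n) {u : Fin c × Fin n →₀ ℕ}
    (hu : u ∈ minGens (I n)) (s : ℕ) : monWeight s u ≤ sSup (monWeight s '' minGens (I n)) :=
  le_csSup ⟨B, by
    rintro _ ⟨v, hv, rfl⟩
    exact monWeight_le_of_mem_minGens hinv hgen hn hv s⟩ ⟨u, hu, rfl⟩

/-- For fixed `s`, column deletion makes the bounded sets of weights decrease with `n`. The limits
then decrease with `s`, since fewer columns are considered. -/
theorem exists_iterated_eventually_weightRow_eq (hinv : IsInvariantChain i I)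
    (hgen : IsGeneratedUpTo i r B I) (k : Fin c) :
    ∃ a, ∀ᶠ s in atTop, ∀ᶠ n in atTop, weightRow s k (I n) = a := by
  refine exists_iterated_eventually_eq_of_antitone (fun s => ?_) (Eventually.of_forall fun s => ?_)
  · obtain ⟨S, hS⟩ := exists_eventually_eq_of_subset
      (A := fun n => monWeightRow s k '' minGens (I n)) (B := B)
      ((eventually_gt_atTop i).mono fun n hn => by
        rintro _ ⟨u, hu, rfl⟩
        exact monWeightRow_le_of_mem_minGens hinv hgen hn hu s k)
      ((eventually_gt_atTop (r + (i + s))).mono fun n hn => by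
        rintro _ ⟨u, hu, rfl⟩
        obtain ⟨u', hu', h, -⟩ := exists_mem_minGens_of_succ hinv hgen hn hu
        exact ⟨u', hu', h k⟩)
    exact ⟨sSup S, hS.mono fun n hn => congrArg sSup hn⟩
  · refine (eventually_gt_atTop i).mono fun n hn => csSup_le' ?_
    rintro _ ⟨u, hu, rfl⟩
    refine le_trans ?_ (monWeightRow_le_weightRow hinv hgen hn hu s k)
    exact monWeightRow_le_iff.2 fun j hj => le_monWeightRow k u (by omega)

theorem exists_eventually_monWeight_image_minGensPlus_eq (hinv : IsInvariantChain i I)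
    (hgen : IsGeneratedUpTo i r B I) (s : ℕ) :
    ∃ S, ∀ᶠ n in atTop, monWeight s '' minGensPlus s (I n) = S :=
  exists_eventually_eq_of_subset
    (A := fun n => monWeight s '' minGensPlus s (I n)) (B := B)
    ((eventually_gt_atTop i).mono fun n hn => by
      rintro _ ⟨u, hu, rfl⟩
      exact monWeight_le_of_mem_minGens hinv hgen hn hu.1 s)
    ((eventually_gt_atTop (r + (i + s))).mono fun n hn => by
      rintro _ ⟨u, hu, rfl⟩
      obtain ⟨u', hu', -, h, h'⟩ := exists_mem_minGens_of_succ hinv hgen hn hu.1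
      exact ⟨u', ⟨hu', h' hu.2⟩, h⟩)

theorem exists_eventually_monWeight_image_minGens_eq (hinv : IsInvariantChain i I)
    (hgen : IsGeneratedUpTo i r B I) (s : ℕ) :
    ∃ S, ∀ᶠ n in atTop, monWeight s '' minGens (I n) = S :=
  exists_eventually_eq_of_subset
    (A := fun n => monWeight s '' minGens (I n)) (B := B)
    ((eventually_gt_atTop i).mono fun n hn => by
      rintro _ ⟨u, hu, rfl⟩
      exact monWeight_le_of_mem_minGens hinv hgen hn hu s)
    ((eventually_gt_atTop (r + (i + s))).mono fun n hn => by
      rintro _ ⟨u, hu, rfl⟩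
      obtain ⟨u', hu', -, h, -⟩ := exists_mem_minGens_of_succ hinv hgen hn hu
      exact ⟨u', hu', h⟩)

theorem minGensPlus_antitone {n s t : ℕ} (hst : s ≤ t) (J : Ideal (R K c n)) :
    minGensPlus t J ⊆ minGensPlus s J :=
  fun _ hu => ⟨hu.1, lt_of_le_of_lt hst hu.2⟩

/-- If generators with `min(u) > s` persist for every `s`, then `omega` is a minimum over shrinking
sets, so it increases with `s` and is bounded by `B`. Otherwise it is eventually a maximum of
weights and decreases. -/
theorem exists_iterated_eventually_omega_eq (hinv : IsInvariantChain i I)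
    (hgen : IsGeneratedUpTo i r B I) :
    ∃ a, ∀ᶠ s in atTop, ∀ᶠ n in atTop, omega s (I n) = a := by
  classical
  have hconst : ∀ s, ∃ a, ∀ᶠ n in atTop, omega s (I n) = a := by
    intro s
    obtain ⟨S, hS⟩ := exists_eventually_monWeight_image_minGensPlus_eq hinv hgen s
    obtain ⟨T, hT⟩ := exists_eventually_monWeight_image_minGens_eq hinv hgen s
    refine ⟨if S.Nonempty then sInf S else sSup T, (hS.and hT).mono fun n hn => ?_⟩
    rw [omega, ← hn.1, ← hn.2]
    simp only [Set.image_nonempty]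
  by_cases hplus : ∀ s, ∀ᶠ n in atTop, (minGensPlus s (I n)).Nonempty
  · refine exists_iterated_eventually_eq_of_monotone (B := B) hconst (fun s => ?_) (fun s => ?_)
    · refine ((hplus s).and (eventually_gt_atTop i)).mono fun n hn => ?_
      rw [omega, if_pos hn.1]
      obtain ⟨u, hu⟩ := hn.1
      exact (Nat.sInf_le (Set.mem_image_of_mem _ hu)).trans
        (monWeight_le_of_mem_minGens hinv hgen hn.2 hu.1 s)
    · refine ((hplus s).and (hplus (s + 1))).mono fun n hn => ?_
      rw [omega, omega, if_pos hn.1, if_pos hn.2]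
      obtain ⟨u, hu, hu'⟩ := Nat.sInf_mem (hn.2.image (monWeight (s + 1)))
      rw [← hu']
      refine (Nat.sInf_le
        (Set.mem_image_of_mem _ (minGensPlus_antitone (Nat.le_succ s) _ hu))).trans ?_
      -- All variables of `u` lie beyond column `s + 1`, so lowering the cutoff to `s` does not
      -- raise its weight.
      refine monWeight_le_iff.2 fun k j hj => ?_
      by_cases h0 : u (k, j) = 0
      · rw [h0]
        exact Nat.zero_le _
      · exact le_monWeight k u ((lt_minIndex_iff.1 hu.2).2 k j h0)
  · push Not at hplus
    obtain ⟨s₀, hs₀⟩ := hplus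
    obtain ⟨S, hS⟩ := exists_eventually_monWeight_image_minGensPlus_eq hinv hgen s₀
    have hempty : ∀ᶠ n in atTop, minGensPlus s₀ (I n) = ∅ := by
      -- Emptiness is known only for infinitely many `n`; as the sets of weights are eventually
      -- constant, it holds eventually.
      rcases S.eq_empty_or_nonempty with rfl | hne
      · exact hS.mono fun n hn => Set.image_eq_empty.1 hn
      · obtain ⟨n, hn, hn'⟩ := (hs₀.and_eventually hS).exists
        rw [← hn', hn, Set.image_empty] at hne
        exact absurd hne Set.not_nonempty_empty
    refine exists_iterated_eventually_eq_of_antitone hconst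
      ((eventually_ge_atTop s₀).mono fun s hs => ?_)
    refine (hempty.and (eventually_gt_atTop i)).mono fun n hn => ?_
    have hno : ∀ t, s₀ ≤ t → ¬ (minGensPlus t (I n)).Nonempty := by
      rintro t ht ⟨u, hu⟩
      have := minGensPlus_antitone ht _ hu
      rw [hn.1] at this
      exact this
    rw [omega, omega, if_neg (hno s hs), if_neg (hno (s + 1) (by omega))]
    refine csSup_le' ?_
    rintro _ ⟨u, hu, rfl⟩
    refine le_trans ?_ (monWeight_le_sSup hinv hgen hn.2 hu s)
    exact monWeight_le_iff.2 fun k j hj => le_monWeight k u (by omega)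

end Weights

/-! ### The linear bound -/

section Bound

variable {K : Type*} [Field K] {c : ℕ} {i r B : ℕ} {I : ∀ n, Ideal (R K c n)}

/-- A monomial of the chain can be moved into any `r` columns with sufficiently large exponents,
without changing its first `s` columns. -/
theorem monomial_mem_of_large_columns (hinv : IsInvariantChain i I)
    (hgen : IsGeneratedUpTo i r B I) {s n : ℕ} (his : i ≤ s) (hn : i < n)
    {u b : Fin c × Fin n →₀ ℕ} (hu : MvPolynomial.monomial u (1 : K) ∈ I n)
    (hub : ∀ k (j : Fin n), (j : ℕ) < s → u (k, j) ≤ b (k, j)) {T : Finset (Fin n)}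
    (hT : ∀ j ∈ T, s ≤ (j : ℕ)) (hTb : ∀ j ∈ T, ∀ k, monWeight s u ≤ b (k, j))
    (hcard : r ≤ T.card) : MvPolynomial.monomial b (1 : K) ∈ I n := by
  obtain ⟨m, him, hmr, g, hg, -, φ, hφ, hfix, hle⟩ := hgen n hn u hu
  -- Columns landing among the first `s` stay put; the others go, in order, into `T`, which has room
  -- because `m ≤ r ≤ T.card`.
  let ψ : Fin m → Fin n := fun j =>
    if (φ j : ℕ) < s then φ j else T.orderEmbOfCardLe hcard (Fin.castLE hmr j)
  have hψ₁ : ∀ j, (φ j : ℕ) < s → ψ j = φ j := fun j h => if_pos h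
  have hψ₂ : ∀ j, ¬ (φ j : ℕ) < s → ψ j = T.orderEmbOfCardLe hcard (Fin.castLE hmr j) :=
    fun j h => if_neg h
  have hψT : ∀ j, ¬ (φ j : ℕ) < s → ψ j ∈ T := fun j h => by
    rw [hψ₂ j h]
    exact Finset.orderEmbOfCardLe_mem _ _ _
  refine monomial_mem_of_embedding hinv him hg (φ := ψ) (fun a a' h => ?_) (fun j hj => ?_)
    (fun k j => ?_)
  · have hlt : (φ a : ℕ) < φ a' := hφ h
    by_cases h1 : (φ a' : ℕ) < s
    · rw [hψ₁ a (hlt.trans h1), hψ₁ a' h1]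
      exact hlt
    · by_cases h2 : (φ a : ℕ) < s
      · have h3 := hT _ (hψT a' h1)
        rw [hψ₁ a h2]
        exact Fin.lt_def.2 (lt_of_lt_of_le h2 h3)
      · rw [hψ₂ a h2, hψ₂ a' h1]
        exact (T.orderEmbOfCardLe hcard).strictMono h
  · have h1 := hfix j hj
    rw [hψ₁ j (by omega), h1]
  · refine (hle k j).trans ?_
    by_cases h : (φ j : ℕ) < s
    · rw [hψ₁ j h]
      exact hub k _ h
    · exact (le_monWeight k u (not_lt.1 h)).trans (hTb _ (hψT j h) k)

theorem degree_eq_sum_columns {n : ℕ} (b : Fin c × Fin n →₀ ℕ) :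
    b.degree = ∑ j, ∑ k, b (k, j) := by
  rw [Finsupp.degree_eq_sum, Fintype.sum_prod_type_right]

/-- The degree of a monomial all but few of whose columns have degree at most `C`. -/
theorem degree_le_of_card_le {n s B r C : ℕ} {b : Fin c × Fin n →₀ ℕ} (hB : ∀ v, b v ≤ B)
    {T : Finset (Fin n)} (hT : ∀ j : Fin n, s ≤ (j : ℕ) → j ∉ T → ∑ k, b (k, j) ≤ C)
    (hcard : T.card ≤ r) : b.degree ≤ C * n + (s + r) * (c * B) := by
  classical
  have hcol : ∀ j : Fin n, ∑ k, b (k, j) ≤ c * B := fun j => by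
    refine (Finset.sum_le_sum fun k _ => hB (k, j)).trans ?_
    simp
  -- Only the first `s` columns and those in `T` can exceed `C`, each by at most `c * B`; this is
  -- the source of `(s + r) * (c * B)`.
  have key : ∀ j : Fin n, ∑ k, b (k, j) ≤ C + ((if (j : ℕ) < s then c * B else 0) +
      if j ∈ T then c * B else 0) := by
    intro j
    by_cases hj : (j : ℕ) < s
    · rw [if_pos hj]
      have := hcol j
      omega
    by_cases hjT : j ∈ T
    · rw [if_pos hjT]
      have := hcol j
      omega
    have := hT j (not_lt.1 hj) hjT
    omega
  have hs : (Finset.univ.filter fun j : Fin n => (j : ℕ) < s).card ≤ s := by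
    calc _ = ((Finset.univ.filter fun j : Fin n => (j : ℕ) < s).map Fin.valEmbedding).card :=
          (Finset.card_map _).symm
      _ ≤ (Finset.range s).card := Finset.card_le_card fun x hx => by
          obtain ⟨j, hj, rfl⟩ := Finset.mem_map.1 hx
          simpa using hj
      _ = s := Finset.card_range s
  rw [degree_eq_sum_columns]
  refine (Finset.sum_le_sum fun j _ => key j).trans ?_
  rw [Finset.sum_add_distrib, Finset.sum_add_distrib, ← Finset.sum_filter, Finset.sum_const,
    Finset.sum_const, Finset.sum_ite_mem, Finset.univ_inter, Finset.sum_const, Finset.card_univ,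
    Fintype.card_fin, smul_eq_mul, smul_eq_mul, smul_eq_mul, mul_comm n C, ← add_mul]
  gcongr

/-- This is where the slope `C(𝓘)` arises: the entry below `ω` contributes at most `ω - 1`, and the
other rows at most their weights. -/
theorem sum_le_of_exists_lt {ω : ℕ} {x w : Fin c → ℕ} (hx : ∀ k, x k ≤ w k) (h : ∃ l, x l < ω) :
    ∑ k, x k ≤ ω - 1 + Finset.univ.sup fun l : Fin c => ∑ k ∈ Finset.univ.erase l, w k := by
  obtain ⟨l, hl⟩ := h
  rw [← Finset.add_sum_erase _ _ (Finset.mem_univ l)]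
  refine add_le_add (Nat.le_sub_one_of_lt hl) ((Finset.sum_le_sum fun k _ => hx k).trans ?_)
  exact Finset.le_sup (f := fun l : Fin c => ∑ k ∈ Finset.univ.erase l, w k) (Finset.mem_univ l)

/-- In a multidegree of large total degree, the upper Koszul complex has a cone point. -/
theorem exists_cone_point (hinv : IsInvariantChain i I) (hgen : IsGeneratedUpTo i r B I)
    {s n : ℕ} (his : i ≤ s) (hn : i < n) {w : Fin c → ℕ} {ω p : ℕ}
    (hw : ∀ k, weightRow s k (I n) = w k) (hω : omega s (I n) = ω) {a : Fin c × Fin n →₀ ℕ}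
    (ha : (ω - 1 + Finset.univ.sup fun l : Fin c => ∑ k ∈ Finset.univ.erase l, w k) * n +
      (s + r) * (c * B) + 1 + p < a.degree) :
    ∃ v, a v ≠ 0 ∧ ∀ (ρ : Finset (Fin c × Fin n)) (b : Fin c × Fin n →₀ ℕ), ρ.card = p → v ∉ ρ →
      b + Finsupp.single v 1 + indic ρ = a →
        MvPolynomial.monomial (b + Finsupp.single v 1) (1 : K) ∈ I n →
          MvPolynomial.monomial b (1 : K) ∈ I n := by
  classical
  -- a variable whose exponent exceeds those in all generators is a cone point
  have hbig : ∀ v, (∀ u ∈ minGens (I n), u v < a v) → ∀ (ρ : Finset (Fin c × Fin n))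
      (b : Fin c × Fin n →₀ ℕ), ρ.card = p → v ∉ ρ → b + Finsupp.single v 1 + indic ρ = a →
        MvPolynomial.monomial (b + Finsupp.single v 1) (1 : K) ∈ I n →
          MvPolynomial.monomial b (1 : K) ∈ I n := by
    intro v hv ρ b _ hvρ hab hb
    obtain ⟨u, hu, hub⟩ := exists_mem_minGens_le hb
    refine monomial_mem_of_le hu.1 fun x => ?_
    -- As `v ∉ ρ`, the exponent of `v` in `b` is `a v - 1`, still at least that in `u`.
    by_cases hx : x = v
    · subst hx
      have h1 := hv u hu
      rw [← hab] at h1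
      simp [indic_apply, hvρ] at h1
      omega
    · have h1 := hub x
      simpa [Finsupp.single_apply, Ne.symm hx] using h1
  by_cases h1 : ∃ v, B < a v
  · obtain ⟨v, hv⟩ := h1
    exact ⟨v, by omega, hbig v fun u hu =>
      lt_of_le_of_lt ((exists_eq_embedding_of_mem_minGens hinv hgen hn hu).1 v) hv⟩
  by_cases h2 : ∃ k, ∃ j : Fin n, s ≤ (j : ℕ) ∧ w k < a (k, j)
  · obtain ⟨k, j, hj, hkj⟩ := h2
    refine ⟨(k, j), by omega, hbig _ fun u hu => lt_of_le_of_lt ?_ hkj⟩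
    rw [← hw]
    exact (le_monWeightRow k u hj).trans (monWeightRow_le_weightRow hinv hgen hn hu s k)
  push Not at h1 h2
  by_cases h3 : ∃ k, ∃ j : Fin n, s ≤ (j : ℕ) ∧ a (k, j) ≠ 0
  · obtain ⟨k₀, j₀, hj₀, hkj₀⟩ := h3
    refine ⟨(k₀, j₀), hkj₀, fun ρ b hρ _ hab hb => ?_⟩
    have hba : b ≤ a := by
      rw [← hab, add_assoc]
      exact le_self_add
    have hdeg : b.degree + 1 + p = a.degree := by
      rw [← hab, map_add, map_add, degree_indic, hρ]
      simp
    let T : Finset (Fin n) := Finset.univ.filter fun j => s ≤ (j : ℕ) ∧ ∀ k, ω ≤ b (k, j)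
    -- Every column beyond `s` outside `T` has an entry below `ω`; with fewer than `r` columns in
    -- `T`, the degree of `b` would be too small.
    have hcard : r ≤ T.card := by
      by_contra hlt
      have := degree_le_of_card_le (s := s) (T := T) (r := r)
        (C := ω - 1 + Finset.univ.sup fun l : Fin c => ∑ k ∈ Finset.univ.erase l, w k)
        (fun v => (hba v).trans (h1 v)) (fun j hj hjT => by
          refine sum_le_of_exists_lt (fun k => (hba _).trans (h2 k j hj)) ?_
          by_contra! hcon
          exact hjT (by simp [T, hj, hcon])) (by omega)
      omega
    have hTs : ∀ j ∈ T, s ≤ (j : ℕ) := fun j hj => (Finset.mem_filter.1 hj).2.1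
    have hTω : ∀ j ∈ T, ∀ k, ω ≤ b (k, j) := fun j hj => (Finset.mem_filter.1 hj).2.2
    rw [omega] at hω
    by_cases hplus : (minGensPlus s (I n)).Nonempty
    -- A generator attaining `ω` has no variable in the first `s` columns, so it moves entirely into
    -- `T` and `x^b` lies in the ideal.
    · rw [if_pos hplus] at hω
      obtain ⟨u, hu, huω⟩ := Nat.sInf_mem (hplus.image (monWeight s))
      rw [hω] at huω
      refine monomial_mem_of_large_columns hinv hgen his hn hu.1.1 (fun k j hj => ?_) hTs
        (fun j hj k => huω.le.trans (hTω j hj k)) hcard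
      have : u (k, j) = 0 := by
        by_contra h0
        exact absurd ((lt_minIndex_iff.1 hu.2).2 k j h0) (not_le.2 hj)
      rw [this]
      exact Nat.zero_le _
    -- Here `ω` bounds the weights of all generators. A generator dividing `x^b` times the chosen
    -- variable already divides `x^b` in the first `s` columns, because that variable lies beyond
    -- them.
    · rw [if_neg hplus] at hω
      obtain ⟨u, hu, hub⟩ := exists_mem_minGens_le hb
      refine monomial_mem_of_large_columns hinv hgen his hn hu.1 (fun k j hj => ?_) hTs
        (fun j hj k => ?_) hcard
      · have hne : (k₀, j₀) ≠ (k, j) := by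
          rintro ⟨⟩
          exact absurd hj (not_lt.2 hj₀)
        have h4 := hub (k, j)
        rwa [Finsupp.add_apply, Finsupp.single_eq_of_ne (Ne.symm hne), add_zero] at h4
      · refine le_trans ?_ (hTω j hj k)
        rw [← hω]
        exact monWeight_le_sSup hinv hgen hn hu s
  · -- all exponents are in the first `s` columns
    push Not at h3
    exfalso
    have h4 := degree_le_of_card_le (s := s) (T := ∅) (r := r) (C := 0) (b := a) h1
      (fun j hj _ => (Finset.sum_eq_zero fun k _ => h3 k j hj).le) (by simp)
    rw [zero_mul, zero_add] at h4
    omega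

theorem reg_le_of_cone_points {n : ℕ} {J : Ideal (R K c n)} (hJ : IsMonomialIdeal J) {M : ℕ}
    (hcone : ∀ p (a : Fin c × Fin n →₀ ℕ), M + p < a.degree → ∃ v, a v ≠ 0 ∧
      ∀ (ρ : Finset (Fin c × Fin n)) (b : Fin c × Fin n →₀ ℕ), ρ.card = p → v ∉ ρ →
        b + Finsupp.single v 1 + indic ρ = a →
          MvPolynomial.monomial (b + Finsupp.single v 1) (1 : K) ∈ J →
            MvPolynomial.monomial b (1 : K) ∈ J) :
    reg J ≤ (((M : ℤ) : ℝ) : EReal) := by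
  refine iSup_le fun p => iSup_le fun j => iSup_le fun h => ?_
  obtain ⟨F, z, hz, hz'⟩ := h
  rw [EReal.coe_le_coe_iff, Int.cast_le]
  by_contra! hlt
  refine hz' (F.cycles_le_boundaries hJ (fun a ha => hcone p a ?_) hz)
  omega

end Bound

end IncChain

end

/-! ### The main theorem -/

theorem mainTheorem1 {K : Type*} [Field K] (c : ℕ) (hc : 1 ≤ c) (i : ℕ)
    (I : ∀ n : ℕ, Ideal (IncChain.R K c n))
    (hmon : ∀ n, 1 ≤ n → IncChain.IsMonomialIdeal (I n))
    (hinv : IncChain.IsInvariantChain i I)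
    (hne : ∃ n, 1 ≤ n ∧ I n ≠ ⊥) :
    -- the stabilized weights are well defined
    (∀ k : Fin c, ∀ᶠ i' in Filter.atTop, ∀ᶠ n in Filter.atTop,
      IncChain.weightRow i' k (I n) = IncChain.chainWeightRow k I) ∧
    (∀ᶠ i' in Filter.atTop, ∀ᶠ n in Filter.atTop,
      IncChain.omega i' (I n) = IncChain.chainOmega I) ∧
    -- the linear bound
    ∃ D : ℤ, ∀ᶠ n : ℕ in Filter.atTop,
      IncChain.reg (I n) ≤ (((IncChain.boundCoeff I * (n : ℤ) + D : ℤ) : ℝ) : EReal) := by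
  obtain ⟨r, B, hgen⟩ := IncChain.exists_bounded_embedding i
    (fun n u => MvPolynomial.monomial u (1 : K) ∈ I n)
  have hgen : IncChain.IsGeneratedUpTo i r B I := hgen
  have hw : ∀ k : Fin c, ∀ᶠ i' in Filter.atTop, ∀ᶠ n in Filter.atTop,
      IncChain.weightRow i' k (I n) = IncChain.chainWeightRow k I := fun k =>
    IncChain.iterated_eventually_eq_eventualValue
      (IncChain.exists_iterated_eventually_weightRow_eq hinv hgen k)
  have hω : ∀ᶠ i' in Filter.atTop, ∀ᶠ n in Filter.atTop,
      IncChain.omega i' (I n) = IncChain.chainOmega I :=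
    IncChain.iterated_eventually_eq_eventualValue
      (IncChain.exists_iterated_eventually_omega_eq hinv hgen)
  refine ⟨hw, hω, ?_⟩
  -- A single cutoff `s ≥ i` serves `ω` and all of the finitely many rows.
  obtain ⟨s, ⟨hws, hωs⟩, his⟩ :=
    (((Filter.eventually_all.2 hw).and hω).and (Filter.eventually_ge_atTop i)).exists
  refine ⟨((s + r) * (c * B) + 1 : ℕ), ?_⟩
  filter_upwards [Filter.eventually_all.2 hws, hωs, Filter.eventually_gt_atTop i]
    with n hwn hωn hn
  refine (IncChain.reg_le_of_cone_points (hmon n (by omega)) fun p a ha =>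
    IncChain.exists_cone_point hinv hgen his hn hwn hωn ha).trans ?_
  rw [EReal.coe_le_coe_iff, Int.cast_le, IncChain.boundCoeff]
  -- The maximum with `0` is exactly truncated subtraction in `ℕ`.
  have h1 : max ((IncChain.chainOmega I : ℤ) - 1) 0 = ((IncChain.chainOmega I - 1 : ℕ) : ℤ) := by
    omega
  rw [h1]
  push_cast
  exact (add_assoc _ _ _).le
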